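/- Let $\omega=\frac{-1+\sqrt{-3}}{2}$, let $E_\omega=\mathbf{C}/(\mathbf{Z}+\mathbf{Z}\omega)$, and let $Y$ be the canonical resolution of the quotient threefold $E_\omega\times E_\omega\times E_\omega/\langle \mathrm{diag}(-\omega,-\omega,-\omega)\rangle$, that is, its blow-up at its singular points, which are of type $\frac12(1,1,1)$, $\frac13(1,1,1)$ and $\frac16(1,1,1)$. Then the smooth projective threefold $Y$ is birationally equivalent to the affine hypersurface $Q$ in the affine space $\mathbf{A}^4$ over $\mathbf{C}$ with coordinates $(t,s,z,w)$ defined by $$(w^3-1)(t^2-1)=(z^3-1)(s^2-1).$$ Here birational equivalence means that there is an isomorphism from a dense Zariski open subset of $Y$ to a dense Zariski open subset of $Q$ whose coordinate functions are rational (equivalently, meromorphic) functions on $Y$. -/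

import Mathlib

open scoped Topology LinearAlgebra.Projectivization

noncomputable section

namespace TorusQuotient

/-! ### The elliptic curve `E_ω` and the group `⟨-ω⟩` -/

/-- `ω = (-1 + √-3) / 2`. -/
def omega : ℂ := (-1 + (Real.sqrt 3 : ℂ) * Complex.I) / 2

theorem omega_sq : omega * omega = -1 - omega := by
  have h3 : (Real.sqrt 3 : ℂ) * (Real.sqrt 3 : ℂ) = 3 := by
    rw [← Complex.ofReal_mul, Real.mul_self_sqrt (by norm_num)]; norm_num
  have hI := Complex.I_mul_I
  unfold omega
  linear_combination (1 / 4 : ℂ) * Complex.I * Complex.I * h3 + (3 / 4 : ℂ) * hI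

theorem neg_omega_mul : (-omega) * (1 + omega) = 1 := by
  linear_combination -omega_sq

/-- `-ω` as a unit of `ℂ`; it is a primitive sixth root of unity. -/
def negOmega : ℂˣ where
  val := -omega
  inv := 1 + omega
  val_inv := neg_omega_mul
  inv_val := by rw [mul_comm]; exact neg_omega_mul

/-- The cyclic group of order six generated by `-ω`. It acts on `ℂ³`, and on `E_ω³`, by the scalar
matrices `diag(ζ, ζ, ζ)`. -/
def G : Subgroup ℂˣ := Subgroup.zpowers negOmega

/-- The lattice `ℤ + ℤω`. -/
def lattice : AddSubgroup ℂ := AddSubgroup.closure {1, omega}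

/-- The elliptic curve `E_ω = ℂ / (ℤ + ℤω)`. -/
abbrev Eomega : Type := ℂ ⧸ lattice

/-- The three-dimensional complex vector space `ℂ³`, the universal cover of `E_ω³`. -/
abbrev C3 : Type := Fin 3 → ℂ

/-- The covering map `ℂ³ → E_ω³`. -/
def toTorus (z : C3) : Fin 3 → Eomega := fun i => (z i : Eomega)

/-! ### The blow-up at the points with non-trivial stabiliser -/

/-- The points of `ℂ³` lying over those points of `E_ω³` that are fixed by `diag(ζ, ζ, ζ)` for some
`ζ ≠ 1` in `⟨-ω⟩`. It is a discrete set, and it is the inverse image in `ℂ³` of the singular locus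
of `E_ω³ / ⟨diag(-ω, -ω, -ω)⟩`. -/
def fixedPoints : Set C3 :=
  {p | ∃ ζ ∈ G, ζ ≠ 1 ∧ toTorus ((ζ : ℂ) • p) = toTorus p}

/-- The quotient topology on the complex projective plane. -/
instance : TopologicalSpace (ℙ ℂ C3) :=
  inferInstanceAs (TopologicalSpace (Quotient (projectivizationSetoid ℂ C3)))

/-- The blow-up of `ℂ³` at the discrete set `fixedPoints`, as an incidence variety: a point is a
point `z` of `ℂ³` together with, for every blown up point `p`, a line `ℓ p` through the origin that
contains `z - p`. The line `ℓ p` is determined by `z` unless `z = p`. -/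
@[ext]
structure BlowUp where
  /-- The image in `ℂ³`. -/
  z : C3
  /-- The line attached to each blown up point. -/
  line : fixedPoints → ℙ ℂ C3
  /-- The incidence relation. -/
  incident : ∀ p : fixedPoints, z - (p : C3) ∈ (line p).submodule

/-- The topology of the blow-up as a subspace of `ℂ³ × (ℙ²)^fixedPoints`. -/
instance : TopologicalSpace BlowUp :=
  TopologicalSpace.induced (fun x => (x.z, x.line)) inferInstance

/-- The affine coordinates `(v₀ / vᵢ, v₁ / vᵢ, v₂ / vᵢ)` of a point `[v₀ : v₁ : v₂]` of `ℙ²`. -/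
def affineCoord (i : Fin 3) (ℓ : ℙ ℂ C3) : C3 := fun j => ℓ.rep j / ℓ.rep i

/-- Holomorphy at a point `x` of the blow-up of a function defined near `x`. Away from the
exceptional divisors the function is locally an analytic function of `z`. At a point over a blown
up point `p` it is locally the restriction of an analytic function on `ℂ³ × ℙ²` (the blow-up being
there the submanifold `{(z, ℓ) | z - p ∈ ℓ}`), the second factor in affine coordinates. -/
def BlowUp.HolAt (f : BlowUp → ℂ) (x : BlowUp) : Prop :=
  (x.z ∉ fixedPoints ∧ ∃ F : C3 → ℂ, AnalyticAt ℂ F x.z ∧ ∀ᶠ y in 𝓝 x, f y = F y.z) ∨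
  (∃ p : fixedPoints, x.z = p ∧ ∃ i : Fin 3, (x.line p).rep i ≠ 0 ∧
    ∃ F : C3 × C3 → ℂ, AnalyticAt ℂ F (x.z, affineCoord i (x.line p)) ∧
      ∀ᶠ y in 𝓝 x, f y = F (y.z, affineCoord i (y.line p)))

/-! ### The threefold `Y` -/

theorem unit_mul_mem_lattice {ζ : ℂˣ} (hζ : ζ ∈ G) {a : ℂ} (ha : a ∈ lattice) :
    (ζ : ℂ) * a ∈ lattice := by
  have h1 : (1 : ℂ) ∈ lattice := AddSubgroup.subset_closure (by simp)
  have hω : omega ∈ lattice := AddSubgroup.subset_closure (by simp)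
  have key : ∀ a ∈ lattice, omega * a ∈ lattice := by
    intro a ha
    induction ha using AddSubgroup.closure_induction with
    | mem x hx =>
      rcases hx with rfl | hx
      · simpa using hω
      · rw [Set.mem_singleton_iff] at hx
        rw [hx, omega_sq]
        exact lattice.sub_mem (lattice.neg_mem h1) hω
    | zero => simp
    | add x y _ _ hx hy => rw [mul_add]; exact lattice.add_mem hx hy
    | neg x _ hx => rw [mul_neg]; exact lattice.neg_mem hx
  obtain ⟨n, rfl⟩ := Subgroup.mem_zpowers_iff.mp hζ
  induction n using Int.induction_on with
  | zero => simpa using ha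
  | succ n ih =>
    have h2 : ((negOmega ^ ((n : ℤ) + 1) : ℂˣ) : ℂ) * a
        = -(omega * (((negOmega ^ (n : ℤ) : ℂˣ) : ℂ) * a)) := by
      have : (negOmega : ℂ) = -omega := rfl
      rw [zpow_add_one, Units.val_mul, this]; ring
    rw [h2]; exact lattice.neg_mem (key _ (ih (Subgroup.zpow_mem_zpowers _ _)))
  | pred n ih =>
    have h2 : ((negOmega ^ (-(n : ℤ) - 1) : ℂˣ) : ℂ) * a
        = ((negOmega ^ (-(n : ℤ)) : ℂˣ) : ℂ) * a
          + omega * (((negOmega ^ (-(n : ℤ)) : ℂˣ) : ℂ) * a) := by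
      have : ((negOmega⁻¹ : ℂˣ) : ℂ) = 1 + omega := rfl
      rw [zpow_sub_one, Units.val_mul, this]; ring
    have h3 := ih (Subgroup.zpow_mem_zpowers _ _)
    rw [h2]; exact lattice.add_mem h3 (key _ h3)

theorem toTorus_eq_iff {z w : C3} : toTorus z = toTorus w ↔ ∀ i, w i - z i ∈ lattice := by
  simp only [toTorus, funext_iff, QuotientAddGroup.eq, sub_eq_neg_add]

theorem toTorus_smul {ζ : ℂˣ} (hζ : ζ ∈ G) {z w : C3} (h : toTorus z = toTorus w) :
    toTorus ((ζ : ℂ) • z) = toTorus ((ζ : ℂ) • w) := by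
  rw [toTorus_eq_iff] at h ⊢
  intro i
  have := unit_mul_mem_lattice hζ (h i)
  simpa [mul_sub] using this

theorem toTorus_add {a b c d : C3} (h : toTorus a = toTorus b) (h' : toTorus c = toTorus d) :
    toTorus (a + c) = toTorus (b + d) := by
  funext i
  have h1 := congrFun h i
  have h2 := congrFun h' i
  simp only [toTorus] at h1 h2 ⊢
  simp only [Pi.add_apply, QuotientAddGroup.mk_add, h1, h2]

/-- The set of blown up points is stable under the affine maps `p ↦ w + ζ (p - z)` that induce
`diag(ζ, ζ, ζ)` on `E_ω³`. -/
theorem fixedPoints_affine {ζ : ℂˣ} (hζ : ζ ∈ G) {z w p : C3}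
    (h : toTorus w = toTorus ((ζ : ℂ) • z)) (hp : p ∈ fixedPoints) :
    w + (ζ : ℂ) • (p - z) ∈ fixedPoints := by
  have e : toTorus (w + (ζ : ℂ) • (p - z)) = toTorus ((ζ : ℂ) • p) := by
    rw [toTorus_add h (rfl : toTorus ((ζ : ℂ) • (p - z)) = _), ← smul_add, add_sub_cancel]
  obtain ⟨ξ, hξ, hne, hfix⟩ := hp
  refine ⟨ξ, hξ, hne, ?_⟩
  rw [toTorus_smul hξ e, e, smul_comm]
  exact toTorus_smul hζ hfix

/-- Two points of the blow-up of `ℂ³` have the same image in `Y` if one is carried to the other by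
an affine automorphism `γ : p ↦ w + ζ (p - z)` of `ℂ³` (here `γ z = w`) with `ζ ∈ ⟨-ω⟩` that induces
`diag(ζ, ζ, ζ)` on `E_ω³`. The linear part of `γ` is scalar, so that it maps every line to itself;
hence `γ` carries the line attached to `p` to the same line, attached to `γ p`. -/
def quotientSetoid : Setoid BlowUp where
  r x y := ∃ ζ ∈ G, toTorus y.z = toTorus ((ζ : ℂ) • x.z) ∧
    ∀ p p' : fixedPoints, (p' : C3) = y.z + (ζ : ℂ) • ((p : C3) - x.z) → y.line p' = x.line p
  iseqv := by
    refine ⟨?_, ?_, ?_⟩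
    · intro x
      refine ⟨1, G.one_mem, by simp, ?_⟩
      intro p p' h
      have : p' = p := Subtype.ext (by simpa using h)
      rw [this]
    · rintro x y ⟨ζ, hζ, hT, hl⟩
      refine ⟨ζ⁻¹, G.inv_mem hζ, ?_, ?_⟩
      · have := toTorus_smul (G.inv_mem hζ) hT
        rw [this, smul_smul]
        simp
      · intro p p' h
        refine (hl p' p ?_).symm
        rw [h, add_sub_cancel_left, smul_smul]
        simp
    · rintro x y w ⟨ζ, hζ, hT, hl⟩ ⟨ξ, hξ, hT', hl'⟩
      refine ⟨ξ * ζ, G.mul_mem hξ hζ, ?_, ?_⟩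
      · rw [hT', toTorus_smul hξ hT, smul_smul, Units.val_mul]
      · intro p p' h
        rw [← hl p ⟨_, fixedPoints_affine hζ hT p.2⟩ rfl]
        refine hl' _ _ ?_
        rw [h, add_sub_cancel_left, smul_smul, Units.val_mul]

/-- The threefold `Y`, the canonical resolution of `E_ω³ / ⟨diag(-ω, -ω, -ω)⟩`. Near a point with
stabiliser of order `m > 1` the quotient is `ℂ³ / μ_m` with `μ_m` acting by scalars (a singularity
of type `1/m(1,1,1)`), and its blow-up at the singular point is the quotient by `μ_m` of the blow-up
of `ℂ³` at the origin. -/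
def Y : Type := Quotient quotientSetoid

/-- The quotient map from the blow-up of `ℂ³` to `Y`. -/
def Y.mk (x : BlowUp) : Y := Quotient.mk quotientSetoid x

instance : TopologicalSpace Y := inferInstanceAs (TopologicalSpace (Quotient quotientSetoid))

/-- Holomorphy at `y` of a function defined near `y`: the structure sheaf of a quotient is the sheaf
of invariant holomorphic functions upstairs. -/
def Y.HolAt (f : Y → ℂ) (y : Y) : Prop :=
  ∀ x : BlowUp, Y.mk x = y → BlowUp.HolAt (fun x' => f (Y.mk x')) x

/-- `A` is an analytic subset of `Y`: near every point of `Y` it is the set of common zeros of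
finitely many holomorphic functions. (As `Y` is projective, these are the Zariski closed sets.) -/
def Y.IsAnalyticSubset (A : Set Y) : Prop :=
  ∀ y : Y, ∃ V : Set Y, IsOpen V ∧ y ∈ V ∧ ∃ (n : ℕ) (h : Fin n → Y → ℂ),
    (∀ k, ∀ y' ∈ V, Y.HolAt (h k) y') ∧ ∀ y' ∈ V, (y' ∈ A ↔ ∀ k, h k y' = 0)

/-- A function `f`, given on a dense open subset `U` of `Y`, is a meromorphic function on `Y`: near
every point of `Y`, also outside `U`, it is a quotient of holomorphic functions whose denominator
vanishes on no non-empty open set. (As `Y` is projective, these are the rational functions.) -/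
def Y.IsMeromorphic (U : Set Y) (f : U → ℂ) : Prop :=
  ∀ y : Y, ∃ V : Set Y, IsOpen V ∧ y ∈ V ∧ ∃ g h : Y → ℂ,
    (∀ y' ∈ V, Y.HolAt g y' ∧ Y.HolAt h y') ∧
    V ⊆ closure {y' ∈ V | h y' ≠ 0} ∧
    ∀ u : U, (u : Y) ∈ V → h u * f u = g u

/-! ### Birational equivalence with an affine variety -/

/-- `U` is a Zariski open and Zariski dense subset of the closed subvariety `Q` of `𝔸ⁿ`. -/
def IsZariskiDenseOpen {n : ℕ} (Q U : Set (Fin n → ℂ)) : Prop :=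
  (∃ J : Set (MvPolynomial (Fin n) ℂ), U = {q ∈ Q | ∃ P ∈ J, MvPolynomial.eval q P ≠ 0}) ∧
  ∀ P : MvPolynomial (Fin n) ℂ,
    (∀ q ∈ U, MvPolynomial.eval q P = 0) → ∀ q ∈ Q, MvPolynomial.eval q P = 0

/-- `Y` is birationally equivalent to the affine variety `Q ⊆ 𝔸ⁿ`: there are dense Zariski open
subsets `U ⊆ Y` and `U' ⊆ Q` and an isomorphism `e : U ≅ U'` (a homeomorphism under which the
holomorphic functions of `Y` correspond to the local restrictions to `Q` of analytic functions on
`ℂⁿ`) which is rational, i.e. whose coordinates are meromorphic functions on all of `Y`.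
The inverse is then rational too: `Y` is projective, so that its meromorphic functions are its
rational functions, and a dominant rational map that is injective on a dense open set has
degree one. -/
def Y.BirationalTo {n : ℕ} (Q : Set (Fin n → ℂ)) : Prop :=
  ∃ (U : Set Y) (U' : Set (Fin n → ℂ)) (e : U ≃ₜ U'),
    Y.IsAnalyticSubset Uᶜ ∧ Dense U ∧ IsZariskiDenseOpen Q U' ∧
    (∀ (u : U) (h : Y → ℂ), Y.HolAt h u ↔
      ∃ F : (Fin n → ℂ) → ℂ, AnalyticAt ℂ F (e u : Fin n → ℂ) ∧
        ∀ᶠ u' : U in 𝓝 u, h (u' : Y) = F (e u' : Fin n → ℂ)) ∧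
    ∀ k : Fin n, Y.IsMeromorphic U (fun u => (e u : Fin n → ℂ) k)

/-- The hypersurface `(w³ - 1)(t² - 1) = (z³ - 1)(s² - 1)` in `𝔸⁴` with coordinates
`(t, s, z, w)`. -/
def hypersurfaceQ : Set (Fin 4 → ℂ) :=
  {q | (q 3 ^ 3 - 1) * (q 0 ^ 2 - 1) = (q 2 ^ 3 - 1) * (q 1 ^ 2 - 1)}

end TorusQuotient

end

/-! By the Weierstrass functions, `E_ω` is the curve y² = x³ + 1, on which `-ω` acts by (x, y) ↦
(ωx, -y). Hence t = y₀/y₂, s = y₁/y₂, z = x₀/x₂, w = x₁/x₂ are invariant functions on `E_ω³` and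
descend to `Y`. Put X = x₂³ and Y = y₂². The three curve equations become the linear equations Y = X
+ 1, t²Y = z³X + 1 and s²Y = w³X + 1, and their compatibility is the equation of `Q`.

Conversely, if z³ ≠ t², the first two equations determine X and Y from (t, z). What remains is to
choose a cube root x₂ of X and a square root y₂ of Y. When both are nonzero, these six choices form
one orbit of the group of order six. So the ratios give a bijection between explicit open sets
`regularY` and `regularImage` (`exists_smul_of_ratioMap_eq`, `exists_ratioMap_eq`). Analytic
branches of the roots make it an isomorphism (`exists_local_section`, `holAt_iff`).

The needed facts about elliptic functions (surjectivity of ℘, separation of points by ℘ and ℘', g₃ ≠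
0) come from Liouville's theorem and from ℘'' = 6℘² - g₂/2. Near poles and exceptional divisors,
invariant expressions in homogeneous coordinates [f : g] of x or y on each factor give the defining
equation of the complement of `regularY` (`isAnalyticSubset_compl_regularY`) and the fractions
required for meromorphy (`isMeromorphic_ratio`). The blow-up itself enters mainly through density
(`BlowUp.dense_preimage_regularLocus`). -/

noncomputable section

/-! ### Linear second order equations -/

/-- A solution of a linear equation of second order without first order term, with analytic
coefficient and zero initial values, vanishes. -/
theorem AnalyticAt.eventually_eq_zero_of_deriv_deriv {d k : ℂ → ℂ} {a : ℂ}
    (hd : AnalyticAt ℂ d a) (hk : AnalyticAt ℂ k a) (h0 : d a = 0) (h1 : deriv d a = 0)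
    (h2 : ∀ᶠ z in 𝓝 a, deriv (deriv d) z = k z * d z) : ∀ᶠ z in 𝓝 a, d z = 0 := by
  rw [← analyticOrderAt_eq_top]
  -- The initial values force ord d'' = ord d - 2, while the equation gives ord d'' ≥ ord d; only
  -- infinite order is consistent with both.
  have e1 := hd.analyticOrderAt_deriv_add_one
  have e2 := hd.deriv.analyticOrderAt_deriv_add_one
  have e3 : analyticOrderAt (deriv (deriv d)) a = analyticOrderAt k a + analyticOrderAt d a := by
    rw [← analyticOrderAt_mul hk hd]
    exact analyticOrderAt_congr h2
  simp only [h0, h1, sub_zero] at e1 e2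
  rw [e3] at e2
  by_contra hne
  lift analyticOrderAt d a to ℕ using hne with n
  rw [← e2] at e1
  generalize analyticOrderAt k a = m at e1
  induction m with
  | top => simp at e1
  | coe m => norm_cast at e1; omega

/-! ### Weierstrass functions of an arbitrary lattice -/

namespace PeriodPair

variable (L : PeriodPair)

theorem isOpen_compl_lattice : IsOpen ((L.lattice : Set ℂ)ᶜ) := L.isClosed_lattice.isOpen_compl

theorem countable_lattice : (L.lattice : Set ℂ).Countable :=
  Set.countable_coe_iff.mp (L.latticeEquivProd.injective.countable)

theorem analyticAt_weierstrassP {z : ℂ} (hz : z ∉ L.lattice) : AnalyticAt ℂ L.weierstrassP z :=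
  L.analyticOnNhd_weierstrassP z hz

theorem analyticAt_derivWeierstrassP {z : ℂ} (hz : z ∉ L.lattice) :
    AnalyticAt ℂ L.derivWeierstrassP z :=
  L.analyticOnNhd_derivWeierstrassP z hz

theorem eventually_notMem_lattice {l : ℂ} : ∀ᶠ z in 𝓝 l, z ≠ l → z ∉ L.lattice := by
  filter_upwards [L.compl_lattice_sdiff_singleton_mem_nhds l] with z hz hne hmem
  exact hz ⟨hmem, hne⟩

/-- Removing the summand of `l` from ℘ leaves a function analytic at `l`, and the removed summand
times (z - l)² is 1 - (z - l)²/l². For l = 0 the division by zero yields 0, which is the correct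
term. -/
theorem exists_sq_mul_weierstrassP_eq {l : ℂ} (hl : l ∈ L.lattice) :
    ∃ h : ℂ → ℂ, AnalyticAt ℂ h l ∧ h l = 1 ∧
      ∀ z, z ≠ l → (z - l) ^ 2 * L.weierstrassP z = h z := by
  refine ⟨fun z => (z - l) ^ 2 * L.weierstrassPExcept l z + 1 - (z - l) ^ 2 / l ^ 2, ?_, ?_, ?_⟩
  · have := L.analyticAt_weierstrassPExcept l
    fun_prop
  · simp
  · intro z hz
    have := L.ite_eq_one_sub_sq_mul_weierstrassP l hl z
    rwa [if_neg hz] at this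

theorem exists_pow_mul_derivWeierstrassP_eq {l : ℂ} (hl : l ∈ L.lattice) :
    ∃ h : ℂ → ℂ, AnalyticAt ℂ h l ∧ h l = -2 ∧
      ∀ z, z ≠ l → (z - l) ^ 3 * L.derivWeierstrassP z = h z := by
  refine ⟨fun z => (z - l) ^ 3 * L.derivWeierstrassPExcept l z - 2, ?_, ?_, ?_⟩
  · have := L.analyticAt_derivWeierstrassPExcept l
    fun_prop
  · simp
  · intro z hz
    have hz' : z - l ≠ 0 := sub_ne_zero.mpr hz
    have := L.derivWeierstrassPExcept_sub ⟨l, hl⟩ z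
    rw [← this]
    field_simp

/-- A function with a pole at `l` and with the value `0` there has an analytic inverse. -/
theorem _root_.AnalyticAt.inv_of_pole {f h : ℂ → ℂ} {l : ℂ} {n : ℕ} (hn : n ≠ 0)
    (hh : AnalyticAt ℂ h l) (h0 : h l ≠ 0) (hf : f l = 0)
    (e : ∀ z, z ≠ l → (z - l) ^ n * f z = h z) :
    AnalyticAt ℂ (fun z => (f z)⁻¹) l ∧ ∀ᶠ z in 𝓝 l, z ≠ l → f z ≠ 0 := by
  have hne := hh.continuousAt.eventually_ne h0
  constructor
  · have : AnalyticAt ℂ (fun z => (z - l) ^ n * (h z)⁻¹) l :=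
      ((analyticAt_id.sub analyticAt_const).pow n).mul (hh.inv h0)
    refine this.congr ?_
    filter_upwards [hne] with z hz
    by_cases hzl : z = l
    · subst hzl; simp [hf, hn]
    · have : (z - l) ^ n ≠ 0 := pow_ne_zero _ (sub_ne_zero.mpr hzl)
      rw [← e z hzl, mul_inv, ← mul_assoc, mul_inv_cancel₀ this, one_mul]
  · filter_upwards [hne] with z hz hzl h
    exact hz (by rw [← e z hzl, h, mul_zero])

theorem weierstrassP_of_mem {l : ℂ} (hl : l ∈ L.lattice) : L.weierstrassP l = 0 :=
  L.weierstrassP_coe ⟨l, hl⟩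

theorem derivWeierstrassP_of_mem {l : ℂ} (hl : l ∈ L.lattice) : L.derivWeierstrassP l = 0 :=
  L.derivWeierstrassP_coe ⟨l, hl⟩

theorem weierstrassP_pole {l : ℂ} (hl : l ∈ L.lattice) :
    AnalyticAt ℂ (fun z => (L.weierstrassP z)⁻¹) l ∧
      ∀ᶠ z in 𝓝 l, z ≠ l → L.weierstrassP z ≠ 0 := by
  obtain ⟨h, h1, h2, h3⟩ := L.exists_sq_mul_weierstrassP_eq hl
  exact AnalyticAt.inv_of_pole two_ne_zero h1 (by simp [h2]) (L.weierstrassP_of_mem hl) h3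

theorem derivWeierstrassP_pole {l : ℂ} (hl : l ∈ L.lattice) :
    AnalyticAt ℂ (fun z => (L.derivWeierstrassP z)⁻¹) l ∧
      ∀ᶠ z in 𝓝 l, z ≠ l → L.derivWeierstrassP z ≠ 0 := by
  obtain ⟨h, h1, h2, h3⟩ := L.exists_pow_mul_derivWeierstrassP_eq hl
  exact AnalyticAt.inv_of_pole three_ne_zero h1 (by simp [h2]) (L.derivWeierstrassP_of_mem hl) h3

/-- No function that is continuous at a lattice point agrees with `℘` near that point. -/
theorem false_of_weierstrassP_eventuallyEq {l : ℂ} (hl : l ∈ L.lattice) {f : ℂ → ℂ}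
    (hf : ContinuousAt f l) (h : ∀ᶠ z in 𝓝[≠] l, L.weierstrassP z = f z) : False := by
  obtain ⟨h1, h2⟩ := L.weierstrassP_pole hl
  -- The product f · ℘⁻¹ tends to f(l) · 0 = 0 by continuity, but equals 1 near `l`.
  have t : Filter.Tendsto (fun z => f z * (L.weierstrassP z)⁻¹) (𝓝[≠] l)
      (𝓝 (f l * (L.weierstrassP l)⁻¹)) :=
    ((hf.mul h1.continuousAt).tendsto).mono_left nhdsWithin_le_nhds
  have t' : Filter.Tendsto (fun z => f z * (L.weierstrassP z)⁻¹) (𝓝[≠] l) (𝓝 1) := by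
    refine tendsto_const_nhds.congr' ?_
    filter_upwards [h, h2.filter_mono nhdsWithin_le_nhds, self_mem_nhdsWithin] with z hz hz' hne
    rw [← hz, mul_inv_cancel₀ (hz' hne)]
  have := tendsto_nhds_unique t t'
  simp [L.weierstrassP_of_mem hl] at this

theorem isPreconnected_compl_of_countable {s : Set ℂ} (hs : s.Countable) : IsPreconnected sᶜ :=
  (hs.isConnected_compl_of_one_lt_rank (by simp)).isPreconnected

theorem hasDerivAt_weierstrassP {z : ℂ} (hz : z ∉ L.lattice) :
    HasDerivAt L.weierstrassP (L.derivWeierstrassP z) z := by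
  have := (L.analyticAt_weierstrassP hz).differentiableAt.hasDerivAt
  rwa [L.deriv_weierstrassP] at this

/-- The second derivative of `℘` is `6 ℘² - g₂ / 2`. -/
theorem two_mul_deriv_derivWeierstrassP {z : ℂ} (hz : z ∉ L.lattice) :
    2 * deriv L.derivWeierstrassP z = 12 * L.weierstrassP z ^ 2 - L.g₂ := by
  set U : Set ℂ := (L.lattice : Set ℂ)ᶜ
  have hU : IsPreconnected U := isPreconnected_compl_of_countable L.countable_lattice
  have h1 : AnalyticOnNhd ℂ L.derivWeierstrassP U := L.analyticOnNhd_derivWeierstrassP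
  have h2 : AnalyticOnNhd ℂ
      (fun z => 2 * deriv L.derivWeierstrassP z - (12 * L.weierstrassP z ^ 2 - L.g₂)) U := by
    intro z hz
    have := (h1 z hz).deriv
    have := L.analyticAt_weierstrassP hz
    fun_prop
  -- Differentiating ℘'² = 4℘³ - g₂℘ - g₃ gives the claim multiplied by ℘'. On a connected domain
  -- one factor must vanish identically, and ℘' does not because of its pole.
  have hprod : ∀ z ∈ U, L.derivWeierstrassP z *
      (2 * deriv L.derivWeierstrassP z - (12 * L.weierstrassP z ^ 2 - L.g₂)) = 0 := by
    intro z hz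
    have e : (fun z => L.derivWeierstrassP z ^ 2) =ᶠ[𝓝 z]
        fun z => 4 * L.weierstrassP z ^ 3 - L.g₂ * L.weierstrassP z - L.g₃ := by
      filter_upwards [L.isOpen_compl_lattice.mem_nhds hz] with w hw
      exact L.derivWeierstrassP_sq w hw
    have d1 := ((h1 z hz).differentiableAt.hasDerivAt).pow 2
    have hp := L.hasDerivAt_weierstrassP hz
    have d2 := (((hp.pow 3).const_mul 4).sub (hp.const_mul L.g₂)).sub_const L.g₃
    have := d1.unique (d2.congr_of_eventuallyEq e)
    simp only [Nat.cast_ofNat] at this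
    linear_combination this
  rcases h1.eq_zero_or_eq_zero_of_mul_eq_zero h2 hprod hU with h | h
  · exfalso
    have h0 : (0 : ℂ) ∈ L.lattice := L.lattice.zero_mem
    have hev := (L.derivWeierstrassP_pole h0).2.filter_mono (nhdsWithin_le_nhds (s := {0}ᶜ))
    have hnm := (L.eventually_notMem_lattice (l := 0)).filter_mono (nhdsWithin_le_nhds (s := {0}ᶜ))
    obtain ⟨w, hw1, hw2, hw3⟩ := (hev.and (hnm.and self_mem_nhdsWithin)).exists
    exact hw1 hw3 (h w (hw2 hw3))
  · exact sub_eq_zero.mp (h z hz)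

theorem add_mem_lattice_iff {l : ℂ} (hl : l ∈ L.lattice) {z : ℂ} :
    z + l ∈ L.lattice ↔ z ∈ L.lattice :=
  ⟨fun h => by simpa using L.lattice.sub_mem h hl, fun h => L.lattice.add_mem h hl⟩

/-- Liouville: if ℘ omitted `c`, then 1/(℘ - c), extended by 0 over the lattice, would be entire and
doubly periodic, hence constant; but it vanishes at 0 and not at ω₁/2. -/
theorem exists_weierstrassP_eq (c : ℂ) : ∃ z, z ∉ L.lattice ∧ L.weierstrassP z = c := by
  classical
  by_contra! hc
  set F : ℂ → ℂ := fun z => if z ∈ L.lattice then 0 else (L.weierstrassP z - c)⁻¹ with hF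
  have hFa : ∀ z, AnalyticAt ℂ F z := by
    intro z
    by_cases hz : z ∈ L.lattice
    · obtain ⟨h1, h2⟩ := L.weierstrassP_pole hz
      have h3 : AnalyticAt ℂ
          (fun w => (L.weierstrassP w)⁻¹ / (1 - c * (L.weierstrassP w)⁻¹)) z :=
        h1.div (analyticAt_const.sub (analyticAt_const.mul h1)) (by
          simp [L.weierstrassP_of_mem hz])
      refine h3.congr ?_
      filter_upwards [h2, L.eventually_notMem_lattice (l := z)] with w hw hw'
      by_cases hwz : w = z
      · subst hwz; simp [hF, hz, L.weierstrassP_of_mem hz]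
      · have e1 := hw hwz
        have e2 := sub_ne_zero.mpr (hc w (hw' hwz))
        have e3 : 1 - c * (L.weierstrassP w)⁻¹ ≠ 0 := by
          intro h
          apply e2
          field_simp at h
          simpa using h
        simp only [hF, if_neg (hw' hwz)]
        field_simp
    · have := (L.analyticAt_weierstrassP hz).sub (analyticAt_const (v := c))
      refine (this.inv (sub_ne_zero.mpr (hc z hz))).congr ?_
      filter_upwards [L.isOpen_compl_lattice.mem_nhds hz] with w hw
      simp only [hF, Pi.inv_apply, Pi.sub_apply]
      exact (if_neg hw).symm
  have hd : Differentiable ℂ F := fun z => (hFa z).differentiableAt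
  have hper : ∀ z w, w ∈ L.lattice → F (z + w) = F z := by
    intro z w hw
    have : L.weierstrassP (z + w) = L.weierstrassP z := L.weierstrassP_add_coe z ⟨w, hw⟩
    simp only [hF, L.add_mem_lattice_iff hw, this]
  have hconst := hd.apply_eq_apply_of_bounded (IsZLattice.isCompact_range_of_periodic L.lattice _
    hd.continuous hper).isBounded (L.ω₁ / 2) 0
  have hn := L.ω₁_div_two_notMem_lattice
  simp only [hF, if_neg hn, if_pos L.lattice.zero_mem] at hconst
  exact hc _ hn (sub_eq_zero.mp (inv_eq_zero.mp hconst))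

/-- Two points with equal values of `℘` and of its derivative agree modulo the lattice. -/
theorem sub_mem_lattice_of_weierstrassP_eq {a b : ℂ} (ha : a ∉ L.lattice) (hb : b ∉ L.lattice)
    (h : L.weierstrassP a = L.weierstrassP b)
    (h' : L.derivWeierstrassP a = L.derivWeierstrassP b) : b - a ∈ L.lattice := by
  by_contra hab
  -- Both translates solve u'' = 6u² - g₂/2, so their difference d satisfies d'' = 6(f + g)d with
  -- zero initial values at 0, and f = g. At z = -a the function f has a pole, whereas g is regular
  -- there if b - a is not in the lattice.
  set f : ℂ → ℂ := fun z => L.weierstrassP (z + a)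
  set g : ℂ → ℂ := fun z => L.weierstrassP (z + b)
  set S : Set ℂ := ((fun z => z + a) ⁻¹' L.lattice ∪ (fun z => z + b) ⁻¹' L.lattice)ᶜ with hS
  have hSc : IsPreconnected S := by
    refine isPreconnected_compl_of_countable (Set.Countable.union ?_ ?_)
    · exact L.countable_lattice.preimage (add_left_injective a)
    · exact L.countable_lattice.preimage (add_left_injective b)
  have hSo : IsOpen S := by
    refine IsClosed.isOpen_compl (self := IsClosed.union ?_ ?_)
    · exact L.isClosed_lattice.preimage (by fun_prop)
    · exact L.isClosed_lattice.preimage (by fun_prop)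
  have memS : ∀ z, z ∈ S ↔ z + a ∉ L.lattice ∧ z + b ∉ L.lattice := by
    intro z; simp [hS]
  have hfa : AnalyticOnNhd ℂ f S := fun z hz =>
    (L.analyticAt_weierstrassP ((memS z).1 hz).1).comp_of_eq (by fun_prop) rfl
  have hga : AnalyticOnNhd ℂ g S := fun z hz =>
    (L.analyticAt_weierstrassP ((memS z).1 hz).2).comp_of_eq (by fun_prop) rfl
  have h0 : (0 : ℂ) ∈ S := by simp [memS, ha, hb]
  have d1 : ∀ z ∈ S, deriv (f - g) z =
      L.derivWeierstrassP (z + a) - L.derivWeierstrassP (z + b) := by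
    intro z hz
    obtain ⟨h1, h2⟩ := (memS z).1 hz
    exact (((L.hasDerivAt_weierstrassP h1).comp_add_const z a).sub
      ((L.hasDerivAt_weierstrassP h2).comp_add_const z b)).deriv
  have d2 : ∀ z ∈ S, deriv (deriv (f - g)) z = 6 * (f z + g z) * (f - g) z := by
    intro z hz
    obtain ⟨h1, h2⟩ := (memS z).1 hz
    have e : deriv (f - g) =ᶠ[𝓝 z]
        fun z => L.derivWeierstrassP (z + a) - L.derivWeierstrassP (z + b) := by
      filter_upwards [hSo.mem_nhds hz] with w hw using d1 w hw
    rw [e.deriv_eq]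
    have q1 := (L.analyticAt_derivWeierstrassP h1).differentiableAt.hasDerivAt.comp_add_const z a
    have q2 := (L.analyticAt_derivWeierstrassP h2).differentiableAt.hasDerivAt.comp_add_const z b
    rw [(q1.fun_sub q2).deriv]
    simp only [f, g, Pi.sub_apply]
    linear_combination (1 / 2 : ℂ) * L.two_mul_deriv_derivWeierstrassP h1
      - (1 / 2 : ℂ) * L.two_mul_deriv_derivWeierstrassP h2
  have hev : ∀ᶠ z in 𝓝 (0 : ℂ), (f - g) z = 0 := by
    refine AnalyticAt.eventually_eq_zero_of_deriv_deriv (k := fun z => 6 * (f z + g z))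
      ((hfa 0 h0).sub (hga 0 h0)) ?_ ?_ ?_ ?_
    · have := hfa 0 h0
      have := hga 0 h0
      fun_prop
    · simp [f, g, h]
    · rw [d1 0 h0]; simp [h']
    · filter_upwards [hSo.mem_nhds h0] with z hz using d2 z hz
  have hfg : Set.EqOn f g S := hfa.eqOn_of_preconnected_of_eventuallyEq hga hSc h0 (by
    filter_upwards [hev] with z hz using sub_eq_zero.mp hz)
  have hl0 : (0 : ℂ) ∈ L.lattice := L.lattice.zero_mem
  refine L.false_of_weierstrassP_eventuallyEq hl0 (f := fun z => L.weierstrassP (z + (b - a)))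
    ?_ ?_
  · refine ContinuousAt.comp_of_eq (L.analyticAt_weierstrassP hab).continuousAt (by fun_prop) ?_
    simp
  · have hc : ∀ᶠ z in 𝓝 (0 : ℂ), z + (b - a) ∉ L.lattice := by
      have : ContinuousAt (fun z : ℂ => z + (b - a)) 0 := by fun_prop
      refine this.eventually_mem (L.isOpen_compl_lattice.mem_nhds ?_)
      simpa using hab
    filter_upwards [hc.filter_mono nhdsWithin_le_nhds, self_mem_nhdsWithin,
      (L.eventually_notMem_lattice (l := 0)).filter_mono nhdsWithin_le_nhds] with z h1 h2 h3
    have := hfg ((memS (z - a)).2 ⟨by simpa using h3 h2, by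
      rwa [sub_add_eq_add_sub, add_sub_assoc]⟩)
    simp only [f, g, sub_add_cancel] at this
    rw [this]
    congr 1; ring

/-- If `g₂ = 0` then `g₃ ≠ 0`. -/
theorem g₃_ne_zero_of_g₂_eq_zero (h2 : L.g₂ = 0) : L.g₃ ≠ 0 := by
  intro h3
  -- If g₂ = g₃ = 0, then ℘' vanishes wherever ℘ does, and ℘'' = 6℘ · ℘ forces ℘ to vanish
  -- identically, contrary to its pole.
  obtain ⟨a, ha, hPa⟩ := L.exists_weierstrassP_eq 0
  have hPa' : L.derivWeierstrassP a = 0 := by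
    have := L.derivWeierstrassP_sq a ha
    rw [hPa, h2, h3] at this
    simpa using this
  have hev : ∀ᶠ z in 𝓝 a, L.weierstrassP z = 0 := by
    refine AnalyticAt.eventually_eq_zero_of_deriv_deriv (k := fun z => 6 * L.weierstrassP z)
      (L.analyticAt_weierstrassP ha) ?_ hPa ?_ ?_
    · have := L.analyticAt_weierstrassP ha
      fun_prop
    · rw [L.deriv_weierstrassP, hPa']
    · filter_upwards [L.isOpen_compl_lattice.mem_nhds ha] with z hz
      rw [L.deriv_weierstrassP]
      linear_combination (1 / 2 : ℂ) * L.two_mul_deriv_derivWeierstrassP hz - (1 / 2 : ℂ) * h2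
  have hz := L.analyticOnNhd_weierstrassP.eqOn_zero_of_preconnected_of_eventuallyEq_zero
    (isPreconnected_compl_of_countable L.countable_lattice) ha hev
  refine L.false_of_weierstrassP_eventuallyEq L.lattice.zero_mem (f := fun _ => 0)
    continuousAt_const ?_
  filter_upwards [self_mem_nhdsWithin,
    (L.eventually_notMem_lattice (l := 0)).filter_mono nhdsWithin_le_nhds] with z h1 h2
  exact hz (h2 h1)

end PeriodPair

namespace TorusQuotient

/-! ### The group `⟨-ω⟩` -/

theorem omega_pow_three : omega ^ 3 = 1 := by
  linear_combination (omega - 1) * omega_sq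

theorem omega_ne_zero : omega ≠ 0 := by
  intro h
  have := omega_pow_three
  simp [h] at this

theorem omega_ne_one : omega ≠ 1 := by
  intro h
  have := omega_sq
  rw [h] at this
  norm_num at this

theorem negOmega_val : (negOmega : ℂ) = -omega := rfl

theorem negOmega_pow_six : negOmega ^ 6 = 1 := by
  ext
  rw [Units.val_pow_eq_pow_val, negOmega_val]
  push_cast
  linear_combination (omega ^ 3 + 1) * omega_pow_three

theorem exists_pow_of_mem_G {ζ : ℂˣ} (hζ : ζ ∈ G) : ∃ n : ℕ, ζ = negOmega ^ n := by
  have hfin : IsOfFinOrder negOmega :=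
    isOfFinOrder_iff_pow_eq_one.mpr ⟨6, by norm_num, negOmega_pow_six⟩
  obtain ⟨n, hn⟩ := Submonoid.mem_powers_iff _ _ |>.mp (hfin.mem_powers_iff_mem_zpowers.mpr hζ)
  exact ⟨n, hn.symm⟩

theorem pow_six_of_mem_G {ζ : ℂˣ} (hζ : ζ ∈ G) : (ζ : ℂ) ^ 6 = 1 := by
  obtain ⟨n, rfl⟩ := exists_pow_of_mem_G hζ
  rw [← Units.val_pow_eq_pow_val, ← pow_mul, mul_comm, pow_mul, negOmega_pow_six, one_pow,
    Units.val_one]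

theorem eq_one_of_pow {ζ : ℂ} (h3 : ζ ^ 3 = 1) (h4 : ζ ^ 4 = 1) : ζ = 1 := by
  linear_combination h4 - ζ * h3

/-- A cube root of unity times a sign is the value of an element of `⟨-ω⟩`. -/
theorem exists_mem_G {ξ ε : ℂ} (hξ : ξ ^ 3 = 1) (hε : ε ^ 2 = 1) :
    ∃ ζ ∈ G, (ζ : ℂ) ^ 4 = ξ ∧ (ζ : ℂ) ^ 3 = ε := by
  have hg : ∀ n : ℕ, negOmega ^ n ∈ G := fun n => G.pow_mem (Subgroup.mem_zpowers _) n
  have hv : ∀ n : ℕ, ((negOmega ^ n : ℂˣ) : ℂ) = (-omega) ^ n := fun n => by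
    rw [Units.val_pow_eq_pow_val, negOmega_val]
  have h3 := omega_pow_three
  have h1 : ∃ ζ ∈ G, (ζ : ℂ) = ξ := by
    have hξ' : (ξ - 1) * ((ξ - omega) * (ξ - omega ^ 2)) = 0 := by
      linear_combination hξ - (1 - ξ) * omega_pow_three - (ξ ^ 2 - ξ) * omega_sq
    rcases mul_eq_zero.mp hξ' with h | h
    · exact ⟨1, G.one_mem, by simpa using (sub_eq_zero.mp h).symm⟩
    rcases mul_eq_zero.mp h with h | h
    · exact ⟨negOmega ^ 4, hg 4, by rw [hv]; linear_combination omega * h3 - h⟩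
    · exact ⟨negOmega ^ 2, hg 2, by rw [hv]; linear_combination -h⟩
  have h2 : ∃ ζ ∈ G, (ζ : ℂ) = ε := by
    rcases sq_eq_one_iff.mp hε with h | h
    · exact ⟨1, G.one_mem, by simpa using h.symm⟩
    · exact ⟨negOmega ^ 3, hg 3, by rw [hv]; linear_combination -h3 - h⟩
  obtain ⟨ζ, hζ, rfl⟩ := h1
  obtain ⟨η, hη, rfl⟩ := h2
  -- With ζ³ = 1 and η² = 1, the fourth power of ζη is ζ and its third power is η.
  refine ⟨ζ * η, G.mul_mem hζ hη, ?_, ?_⟩ <;> rw [Units.val_mul]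
  · linear_combination (ζ : ℂ) * (η : ℂ) ^ 4 * hξ + (ζ : ℂ) * ((η : ℂ) ^ 2 + 1) * hε
  · linear_combination (η : ℂ) ^ 3 * hξ + (η : ℂ) * hε

/-! ### The Weierstrass function of the lattice `ℤ + ℤω` -/

theorem omega_im : omega.im = Real.sqrt 3 / 2 := by
  simp [omega]

/-- The pair of periods `(1, ω)`. -/
def periods : PeriodPair where
  ω₁ := 1
  ω₂ := omega
  indep := by
    rw [LinearIndependent.pair_iff]
    intro s t h
    have h1 := congrArg Complex.im h
    have h2 := congrArg Complex.re h
    simp [omega_im] at h1 h2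
    subst h1
    simpa using h2

theorem mem_periods_lattice {z : ℂ} : z ∈ periods.lattice ↔ z ∈ lattice := by
  rw [lattice, AddSubgroup.mem_closure_pair, PeriodPair.mem_lattice]
  simp [periods]

theorem omega_mul_mem_iff {z : ℂ} : omega * z ∈ lattice ↔ z ∈ lattice := by
  have hm : negOmega ∈ G := Subgroup.mem_zpowers _
  constructor
  · intro h
    have := unit_mul_mem_lattice (G.inv_mem hm) (lattice.neg_mem h)
    rwa [show ((negOmega⁻¹ : ℂˣ) : ℂ) * -(omega * z) = z by
      rw [← neg_mul, ← negOmega_val, Units.inv_mul_cancel_left]] at this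
  · intro h
    have := unit_mul_mem_lattice hm (lattice.neg_mem h)
    rwa [negOmega_val, neg_mul_neg] at this

/-- Multiplication by `ω` on the lattice. -/
def omegaEquiv : periods.lattice ≃ periods.lattice :=
  (Equiv.mulLeft₀ omega omega_ne_zero).subtypeEquiv fun z => by
    simp only [mem_periods_lattice]
    exact omega_mul_mem_iff.symm

theorem omegaEquiv_coe (l : periods.lattice) : (omegaEquiv l : ℂ) = omega * l := rfl

/-- Reindexing the Eisenstein sum of weight 4 by multiplication by ω multiplies it by ω⁻⁴ = ω⁻¹ ≠ 1.
-/
theorem periods_g₂ : periods.g₂ = 0 := by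
  have h : periods.G 4 = omega⁻¹ * periods.G 4 := by
    conv_lhs => rw [PeriodPair.G, ← omegaEquiv.tsum_eq]
    rw [PeriodPair.G, ← tsum_mul_left]
    refine tsum_congr fun l => ?_
    rw [omegaEquiv_coe, mul_pow, mul_inv, pow_succ omega 3, omega_pow_three, one_mul]
  have h' : (1 - omega⁻¹) * periods.G 4 = 0 := by linear_combination h
  have hne : (1 - omega⁻¹) ≠ 0 := by
    rw [sub_ne_zero, ne_comm, Ne, inv_eq_one]
    exact omega_ne_one
  rw [PeriodPair.g₂, (mul_eq_zero.mp h').resolve_left hne, mul_zero]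

/-- The series is homogeneous of degree -2 under scaling of both argument and lattice; the lattice
is stable under ω, and ω⁻² = ω. -/
theorem weierstrassP_omega_mul (z : ℂ) :
    periods.weierstrassP (omega * z) = omega * periods.weierstrassP z := by
  conv_lhs => rw [PeriodPair.weierstrassP, ← omegaEquiv.tsum_eq]
  rw [PeriodPair.weierstrassP, ← tsum_mul_left]
  refine tsum_congr fun l => ?_
  have h : (omega ^ 2)⁻¹ = omega := by
    rw [inv_eq_iff_eq_inv, eq_comm]
    exact inv_eq_of_mul_eq_one_right (by rw [← pow_succ', omega_pow_three])
  rw [omegaEquiv_coe, ← mul_sub, mul_pow, mul_pow]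
  simp only [one_div, mul_inv, h]
  ring

theorem derivWeierstrassP_omega_mul (z : ℂ) :
    periods.derivWeierstrassP (omega * z) = periods.derivWeierstrassP z := by
  conv_lhs => rw [PeriodPair.derivWeierstrassP, ← omegaEquiv.tsum_eq]
  rw [PeriodPair.derivWeierstrassP]
  congr 1
  refine tsum_congr fun l => ?_
  rw [omegaEquiv_coe, ← mul_sub, mul_pow, omega_pow_three, one_mul]

/-! ### The coordinates on `E_ω` with `py² = px³ + 1` -/

theorem periods_g₃_ne_zero : periods.g₃ ≠ 0 :=
  periods.g₃_ne_zero_of_g₂_eq_zero periods_g₂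

/-- Since g₂ = 0, multiplying ℘'² = 4℘³ - g₃ by -1/g₃ yields y² = x³ + 1 once the coefficients are
absorbed by a cube root of -4/g₃ and a square root of -1/g₃. -/
theorem exists_xScale : ∃ c : ℂ, c ^ 3 = -4 / periods.g₃ :=
  IsAlgClosed.exists_pow_nat_eq _ (by norm_num)

theorem exists_yScale : ∃ c : ℂ, c ^ 2 = -1 / periods.g₃ :=
  IsAlgClosed.exists_pow_nat_eq _ (by norm_num)

/-- The factor that normalises `℘`. -/
def xScale : ℂ := exists_xScale.choose

/-- The factor that normalises the derivative of `℘`. -/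
def yScale : ℂ := exists_yScale.choose

theorem xScale_pow : xScale ^ 3 = -4 / periods.g₃ := exists_xScale.choose_spec

theorem yScale_pow : yScale ^ 2 = -1 / periods.g₃ := exists_yScale.choose_spec

theorem xScale_ne_zero : xScale ≠ 0 := by
  intro h
  have := xScale_pow
  rw [h] at this
  field_simp [periods_g₃_ne_zero] at this
  norm_num at this

theorem yScale_ne_zero : yScale ≠ 0 := by
  intro h
  have := yScale_pow
  rw [h] at this
  field_simp [periods_g₃_ne_zero] at this
  norm_num at this

/-- The `x`-coordinate of the curve `y² = x³ + 1`, as an elliptic function; its value at the poles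
is `0`. -/
def px (z : ℂ) : ℂ := xScale * periods.weierstrassP z

/-- The `y`-coordinate of the curve `y² = x³ + 1`, as an elliptic function; its value at the poles
is `0`. -/
def py (z : ℂ) : ℂ := yScale * periods.derivWeierstrassP z

theorem py_sq {z : ℂ} (hz : z ∉ lattice) : py z ^ 2 = px z ^ 3 + 1 := by
  have h := periods.derivWeierstrassP_sq z (mem_periods_lattice.not.mpr hz)
  have h3 := periods_g₃_ne_zero
  rw [px, py, mul_pow, mul_pow, xScale_pow, yScale_pow, h, periods_g₂]
  field_simp
  ring

theorem px_of_mem {z : ℂ} (hz : z ∈ lattice) : px z = 0 := by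
  rw [px, periods.weierstrassP_of_mem (mem_periods_lattice.mpr hz), mul_zero]

theorem py_of_mem {z : ℂ} (hz : z ∈ lattice) : py z = 0 := by
  rw [py, periods.derivWeierstrassP_of_mem (mem_periods_lattice.mpr hz), mul_zero]

theorem isOpen_compl_lattice : IsOpen ((lattice : Set ℂ)ᶜ) := by
  convert periods.isOpen_compl_lattice using 2
  ext z
  exact mem_periods_lattice.symm

theorem countable_lattice : (lattice : Set ℂ).Countable := by
  convert periods.countable_lattice using 1
  ext z
  exact mem_periods_lattice.symm

theorem analyticAt_px {z : ℂ} (hz : z ∉ lattice) : AnalyticAt ℂ px z :=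
  analyticAt_const.mul (periods.analyticAt_weierstrassP (mem_periods_lattice.not.mpr hz))

theorem analyticAt_py {z : ℂ} (hz : z ∉ lattice) : AnalyticAt ℂ py z :=
  analyticAt_const.mul (periods.analyticAt_derivWeierstrassP (mem_periods_lattice.not.mpr hz))

theorem px_add {l : ℂ} (hl : l ∈ lattice) (z : ℂ) : px (z + l) = px z := by
  have := periods.weierstrassP_add_coe z ⟨l, mem_periods_lattice.mpr hl⟩
  rw [px, px, this]

theorem py_add {l : ℂ} (hl : l ∈ lattice) (z : ℂ) : py (z + l) = py z := by
  have := periods.derivWeierstrassP_add_coe z ⟨l, mem_periods_lattice.mpr hl⟩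
  rw [py, py, this]

theorem px_neg (z : ℂ) : px (-z) = px z := by
  rw [px, px, periods.weierstrassP_neg]

theorem py_neg (z : ℂ) : py (-z) = -py z := by
  rw [py, py, periods.derivWeierstrassP_neg, mul_neg]

theorem px_omega_mul (z : ℂ) : px (omega * z) = omega * px z := by
  rw [px, px, weierstrassP_omega_mul]
  ring

theorem py_omega_mul (z : ℂ) : py (omega * z) = py z := by
  rw [py, py, derivWeierstrassP_omega_mul]

/-- On the generator, (-ω)⁴ = ω and (-ω)³ = -1 are the factors by which x and y change; this
explains the exponents 4 here and 3 in `py_smul`. -/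
theorem px_smul {ζ : ℂˣ} (hζ : ζ ∈ G) (z : ℂ) : px (ζ * z) = (ζ : ℂ) ^ 4 * px z := by
  obtain ⟨n, rfl⟩ := exists_pow_of_mem_G hζ
  clear hζ
  induction n with
  | zero => simp
  | succ n ih =>
    rw [pow_succ', Units.val_mul, negOmega_val, mul_assoc, neg_mul, px_neg, px_omega_mul, ih]
    rw [mul_pow, neg_pow, pow_succ omega 3, omega_pow_three]
    ring

theorem py_smul {ζ : ℂˣ} (hζ : ζ ∈ G) (z : ℂ) : py (ζ * z) = (ζ : ℂ) ^ 3 * py z := by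
  obtain ⟨n, rfl⟩ := exists_pow_of_mem_G hζ
  clear hζ
  induction n with
  | zero => simp
  | succ n ih =>
    rw [pow_succ', Units.val_mul, negOmega_val, mul_assoc, neg_mul, py_neg, py_omega_mul, ih]
    rw [mul_pow, neg_pow, omega_pow_three]
    ring

theorem analyticAt_inv_const_mul {f : ℂ → ℂ} {c l : ℂ} (hf : AnalyticAt ℂ (fun z => (f z)⁻¹) l) :
    AnalyticAt ℂ (fun z => (c * f z)⁻¹) l := by
  simp_rw [mul_inv]
  exact analyticAt_const.mul hf

theorem px_pole {l : ℂ} (hl : l ∈ lattice) :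
    AnalyticAt ℂ (fun z => (px z)⁻¹) l ∧ ∀ᶠ z in 𝓝 l, z ≠ l → px z ≠ 0 := by
  obtain ⟨h1, h2⟩ := periods.weierstrassP_pole (mem_periods_lattice.mpr hl)
  refine ⟨analyticAt_inv_const_mul h1, ?_⟩
  filter_upwards [h2] with z hz hne
  exact mul_ne_zero xScale_ne_zero (hz hne)

theorem py_pole {l : ℂ} (hl : l ∈ lattice) :
    AnalyticAt ℂ (fun z => (py z)⁻¹) l ∧ ∀ᶠ z in 𝓝 l, z ≠ l → py z ≠ 0 := by
  obtain ⟨h1, h2⟩ := periods.derivWeierstrassP_pole (mem_periods_lattice.mpr hl)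
  refine ⟨analyticAt_inv_const_mul h1, ?_⟩
  filter_upwards [h2] with z hz hne
  exact mul_ne_zero yScale_ne_zero (hz hne)

theorem deriv_px_ne_zero {z : ℂ} (hy : py z ≠ 0) : deriv px z ≠ 0 := by
  have hz : z ∉ lattice := fun h => hy (py_of_mem h)
  have := (periods.hasDerivAt_weierstrassP (mem_periods_lattice.not.mpr hz)).const_mul xScale
  rw [show px = fun z => xScale * periods.weierstrassP z from rfl, this.deriv]
  exact mul_ne_zero xScale_ne_zero (right_ne_zero_of_mul hy)

/-- As g₂ = 0, the derivative of ℘' is 6℘², which vanishes only with ℘. -/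
theorem deriv_py_ne_zero {z : ℂ} (hx : px z ≠ 0) : deriv py z ≠ 0 := by
  have hz : z ∉ lattice := fun h => hx (px_of_mem h)
  have hz' := mem_periods_lattice.not.mpr hz
  have h := periods.two_mul_deriv_derivWeierstrassP hz'
  have := (periods.analyticAt_derivWeierstrassP hz').differentiableAt.hasDerivAt.const_mul yScale
  rw [show py = fun z => yScale * periods.derivWeierstrassP z from rfl, this.deriv]
  refine mul_ne_zero yScale_ne_zero fun h0 => ?_
  rw [h0, periods_g₂] at h
  have : periods.weierstrassP z = 0 := by simpa using h.symm
  exact hx (by rw [px, this, mul_zero])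

theorem sub_mem_lattice_of_eq {a b : ℂ} (ha : a ∉ lattice) (hb : b ∉ lattice)
    (hx : px a = px b) (hy : py a = py b) : b - a ∈ lattice :=
  mem_periods_lattice.mp <| periods.sub_mem_lattice_of_weierstrassP_eq
    (mem_periods_lattice.not.mpr ha) (mem_periods_lattice.not.mpr hb)
    (mul_left_cancel₀ xScale_ne_zero hx) (mul_left_cancel₀ yScale_ne_zero hy)

/-- Surjectivity of ℘ yields x, which fixes y up to sign; z ↦ -z corrects the sign. -/
theorem exists_px_py {x y : ℂ} (h : y ^ 2 = x ^ 3 + 1) : ∃ z ∉ lattice, px z = x ∧ py z = y := by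
  obtain ⟨z, hz, hzx⟩ := periods.exists_weierstrassP_eq (xScale⁻¹ * x)
  rw [mem_periods_lattice] at hz
  have hx : px z = x := by rw [px, hzx, mul_inv_cancel_left₀ xScale_ne_zero]
  have hy := py_sq hz
  rw [hx, ← h] at hy
  rcases sq_eq_sq_iff_eq_or_eq_neg.mp hy with hy | hy
  · exact ⟨z, hz, hx, hy⟩
  · exact ⟨-z, by rwa [neg_mem_iff], by rw [px_neg, hx], by rw [py_neg, hy, neg_neg]⟩

/-- One-variable inverse function theorem in the form of an analytic right inverse. -/
theorem exists_right_inverse {f : ℂ → ℂ} {a : ℂ} (hf : AnalyticAt ℂ f a) (hd : deriv f a ≠ 0) :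
    ∃ φ : ℂ → ℂ, AnalyticAt ℂ φ (f a) ∧ φ (f a) = a ∧ ∀ᶠ x in 𝓝 (f a), f (φ x) = x :=
  ⟨_, hf.analyticAt_localInverse hd, HasStrictFDerivAt.localInverse_apply_image ..,
    HasStrictDerivAt.eventually_right_inverse ..⟩

/-- A local analytic inverse of the parametrisation of `y² = x³ + 1`. -/
theorem exists_local_parameter {a : ℂ} (ha : a ∉ lattice) :
    ∃ ψ : ℂ × ℂ → ℂ, AnalyticAt ℂ ψ (px a, py a) ∧ ψ (px a, py a) = a ∧
      ∀ᶠ q in 𝓝 (px a, py a), q.2 ^ 2 = q.1 ^ 3 + 1 → px (ψ q) = q.1 ∧ py (ψ q) = q.2 := by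
  have key : ∀ ψ : ℂ × ℂ → ℂ, AnalyticAt ℂ ψ (px a, py a) → ψ (px a, py a) = a →
      ContinuousAt (fun q => px (ψ q)) (px a, py a) ∧ ContinuousAt (fun q => py (ψ q)) (px a, py a)
      ∧ ∀ᶠ q in 𝓝 (px a, py a), ψ q ∉ lattice := by
    intro ψ h1 h2
    refine ⟨?_, ?_, ?_⟩
    · exact (analyticAt_px ha).continuousAt.comp_of_eq h1.continuousAt h2
    · exact (analyticAt_py ha).continuousAt.comp_of_eq h1.continuousAt h2
    · exact h1.continuousAt.eventually_mem (isOpen_compl_lattice.mem_nhds (by rw [h2]; exact ha))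
  by_cases hy : py a = 0
  · have hx : px a ≠ 0 := by
      intro hx
      have := py_sq ha
      simp [hx, hy] at this
    obtain ⟨φ, h1, h2, h3⟩ := exists_right_inverse (analyticAt_py ha) (deriv_py_ne_zero hx)
    have hψ : AnalyticAt ℂ (fun q : ℂ × ℂ => φ q.2) (px a, py a) := h1.comp_of_eq analyticAt_snd rfl
    refine ⟨fun q => φ q.2, hψ, h2, ?_⟩
    obtain ⟨c1, -, c3⟩ := key _ hψ h2
    -- Here y is the local coordinate. The equality of the cubes of x factors, and the quadratic
    -- cofactor equals 3x² ≠ 0 at the base point, so the linear factor must vanish nearby.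
    have hne : ∀ᶠ q : ℂ × ℂ in 𝓝 (px a, py a),
        px (φ q.2) ^ 2 + px (φ q.2) * q.1 + q.1 ^ 2 ≠ 0 := by
      refine ContinuousAt.eventually_ne (by fun_prop) ?_
      simp only [h2]
      rw [show px a ^ 2 + px a * px a + px a ^ 2 = 3 * px a ^ 2 by ring]
      exact mul_ne_zero three_ne_zero (pow_ne_zero _ hx)
    filter_upwards [c3, hne, (continuousAt_snd (p := (px a, py a))).eventually h3]
      with q q1 q2 q3 hq
    refine ⟨?_, q3⟩
    have := py_sq q1
    rw [q3, hq] at this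
    have : (px (φ q.2) - q.1) * (px (φ q.2) ^ 2 + px (φ q.2) * q.1 + q.1 ^ 2) = 0 := by
      linear_combination -this
    exact sub_eq_zero.mp ((mul_eq_zero.mp this).resolve_right q2)
  · obtain ⟨φ, h1, h2, h3⟩ := exists_right_inverse (analyticAt_px ha) (deriv_px_ne_zero hy)
    have hψ : AnalyticAt ℂ (fun q : ℂ × ℂ => φ q.1) (px a, py a) := h1.comp_of_eq analyticAt_fst rfl
    refine ⟨fun q => φ q.1, hψ, h2, ?_⟩
    obtain ⟨-, c2, c3⟩ := key _ hψ h2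
    have hne : ∀ᶠ q : ℂ × ℂ in 𝓝 (px a, py a), py (φ q.1) + q.2 ≠ 0 := by
      refine ContinuousAt.eventually_ne (by fun_prop) ?_
      simp only [h2]
      rw [← two_mul]
      exact mul_ne_zero two_ne_zero hy
    filter_upwards [c3, hne, (continuousAt_fst (p := (px a, py a))).eventually h3]
      with q q1 q2 q3 hq
    refine ⟨q3, ?_⟩
    have := py_sq q1
    rw [q3, ← hq] at this
    have : (py (φ q.1) - q.2) * (py (φ q.1) + q.2) = 0 := by
      linear_combination this
    exact sub_eq_zero.mp ((mul_eq_zero.mp this).resolve_right q2)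

/-! ### The map to the hypersurface -/

/-- The set of `z ∈ ℂ³` on which the map to the hypersurface is regular and a local isomorphism. -/
def regularLocus : Set C3 :=
  {z | z 0 ∉ lattice ∧ z 1 ∉ lattice ∧ px (z 2) ≠ 0 ∧ py (z 2) ≠ 0 ∧ py (z 0) ^ 2 ≠ py (z 2) ^ 2}

/-- The map `(y₀/y₂, y₁/y₂, x₀/x₂, x₁/x₂)` from `ℂ³` to `𝔸⁴`. -/
def ratioMap (z : C3) : Fin 4 → ℂ :=
  ![py (z 0) / py (z 2), py (z 1) / py (z 2), px (z 0) / px (z 2), px (z 1) / px (z 2)]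

/-- The open subset of the hypersurface that is the image of `regularLocus`. -/
def regularImage : Set (Fin 4 → ℂ) :=
  {q | q ∈ hypersurfaceQ ∧ q 0 ^ 2 ≠ 1 ∧ q 2 ^ 3 ≠ 1 ∧ q 2 ^ 3 ≠ q 0 ^ 2}

theorem notMem_lattice_of_mem_regularLocus {z : C3} (hz : z ∈ regularLocus) (i : Fin 3) :
    z i ∉ lattice := by
  obtain ⟨h0, h1, h2, -, -⟩ := hz
  fin_cases i
  · exact h0
  · exact h1
  -- The default value 0 of `px` at its poles makes px(z₂) ≠ 0 exclude lattice points as well.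
  · exact fun h => h2 (px_of_mem h)

theorem mem_lattice_iff_of_toTorus_eq {ζ : ℂˣ} (hζ : ζ ∈ G) {z w : C3}
    (h : toTorus w = toTorus ((ζ : ℂ) • z)) (i : Fin 3) : w i ∈ lattice ↔ z i ∈ lattice := by
  have h := toTorus_eq_iff.mp h i
  simp only [Pi.smul_apply, smul_eq_mul] at h
  constructor
  · intro hw
    have := unit_mul_mem_lattice (G.inv_mem hζ) (lattice.add_mem h hw)
    simpa using this
  · intro hz
    simpa using lattice.sub_mem (unit_mul_mem_lattice hζ hz) h

theorem px_of_toTorus_eq {ζ : ℂˣ} (hζ : ζ ∈ G) {z w : C3}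
    (h : toTorus w = toTorus ((ζ : ℂ) • z)) (i : Fin 3) : px (w i) = (ζ : ℂ) ^ 4 * px (z i) := by
  rw [← px_smul hζ, ← px_add (toTorus_eq_iff.mp h i)]
  simp

theorem py_of_toTorus_eq {ζ : ℂˣ} (hζ : ζ ∈ G) {z w : C3}
    (h : toTorus w = toTorus ((ζ : ℂ) • z)) (i : Fin 3) : py (w i) = (ζ : ℂ) ^ 3 * py (z i) := by
  rw [← py_smul hζ, ← py_add (toTorus_eq_iff.mp h i)]
  simp

theorem regularLocus_iff_of_toTorus_eq {ζ : ℂˣ} (hζ : ζ ∈ G) {z w : C3}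
    (h : toTorus w = toTorus ((ζ : ℂ) • z)) : w ∈ regularLocus ↔ z ∈ regularLocus := by
  have h0 : (ζ : ℂ) ≠ 0 := ζ.ne_zero
  have h6 := pow_six_of_mem_G hζ
  have h6' : ((ζ : ℂ) ^ 3) ^ 2 = 1 := by rw [← pow_mul]; exact h6
  simp [regularLocus, mem_lattice_iff_of_toTorus_eq hζ h, px_of_toTorus_eq hζ h,
    py_of_toTorus_eq hζ h, mul_pow, h6']

theorem ratioMap_of_toTorus_eq {ζ : ℂˣ} (hζ : ζ ∈ G) {z w : C3}
    (h : toTorus w = toTorus ((ζ : ℂ) • z)) : ratioMap w = ratioMap z := by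
  have h0 : (ζ : ℂ) ≠ 0 := ζ.ne_zero
  simp only [ratioMap, px_of_toTorus_eq hζ h, py_of_toTorus_eq hζ h,
    mul_div_mul_left _ _ (pow_ne_zero _ h0)]

/-- A point fixed by ζ satisfies x₂ = ζ⁴x₂ and y₂ = ζ³y₂; as x₂ and y₂ are nonzero, ζ⁴ = ζ³ = 1. -/
theorem notMem_fixedPoints_of_mem_regularLocus {z : C3} (hz : z ∈ regularLocus) :
    z ∉ fixedPoints := by
  rintro ⟨ζ, hζ, hne, h⟩
  have hx := px_of_toTorus_eq hζ h.symm 2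
  have hy := py_of_toTorus_eq hζ h.symm 2
  refine hne (Units.ext (eq_one_of_pow ?_ ?_))
  · exact (mul_eq_right₀ hz.2.2.2.1).mp hy.symm
  · exact (mul_eq_right₀ hz.2.2.1).mp hx.symm

theorem isOpen_regularLocus : IsOpen regularLocus := by
  rw [isOpen_iff_mem_nhds]
  intro z hz
  have hL := notMem_lattice_of_mem_regularLocus hz
  obtain ⟨h0, h1, h2, h3, h4⟩ := hz
  have ev : ∀ i : Fin 3, ContinuousAt (fun w : C3 => w i) z := fun i =>
    (continuous_apply i).continuousAt
  have cx : ∀ i : Fin 3, ContinuousAt (fun w : C3 => px (w i)) z := fun i =>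
    (analyticAt_px (hL i)).continuousAt.comp_of_eq (ev i) rfl
  have cy : ∀ i : Fin 3, ContinuousAt (fun w : C3 => py (w i)) z := fun i =>
    (analyticAt_py (hL i)).continuousAt.comp_of_eq (ev i) rfl
  filter_upwards [(ev 0).eventually_mem (isOpen_compl_lattice.mem_nhds h0),
    (ev 1).eventually_mem (isOpen_compl_lattice.mem_nhds h1), (cx 2).eventually_ne h2,
    (cy 2).eventually_ne h3, (((cy 0).pow 2).sub ((cy 2).pow 2)).eventually_ne (sub_ne_zero.mpr h4)]
    with w w0 w1 w2 w3 w4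
  exact ⟨w0, w1, w2, w3, sub_ne_zero.mp w4⟩

theorem analyticAt_ratioMap {z : C3} (hz : z ∈ regularLocus) : AnalyticAt ℂ ratioMap z := by
  have hL := notMem_lattice_of_mem_regularLocus hz
  obtain ⟨h0, h1, h2, h3, h4⟩ := hz
  have ev : ∀ i : Fin 3, AnalyticAt ℂ (fun w : C3 => w i) z := fun i =>
    (ContinuousLinearMap.proj (R := ℂ) (φ := fun _ : Fin 3 => ℂ) i).analyticAt z
  have cx : ∀ i : Fin 3, AnalyticAt ℂ (fun w : C3 => px (w i)) z := fun i =>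
    (analyticAt_px (hL i)).comp_of_eq (ev i) rfl
  have cy : ∀ i : Fin 3, AnalyticAt ℂ (fun w : C3 => py (w i)) z := fun i =>
    (analyticAt_py (hL i)).comp_of_eq (ev i) rfl
  rw [analyticAt_pi_iff]
  intro k
  fin_cases k
  · exact (cy 0).div (cy 2) h3
  · exact (cy 1).div (cy 2) h3
  · exact (cx 0).div (cx 2) h2
  · exact (cx 1).div (cx 2) h2

/-- Since yᵢ² - y₂² = xᵢ³ - x₂³, both sides of the equation of `Q` equal (x₀³ - x₂³)(x₁³ -
x₂³)/(x₂³y₂²). Each of the three inequalities reduces to y₀² ≠ y₂². -/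
theorem ratioMap_mem_regularImage {z : C3} (hz : z ∈ regularLocus) :
    ratioMap z ∈ regularImage := by
  have hL := notMem_lattice_of_mem_regularLocus hz
  have e := fun i => py_sq (hL i)
  obtain ⟨h0, h1, h2, h3, h4⟩ := hz
  have e0 := e 0
  have e1 := e 1
  have e2 := e 2
  simp only [regularImage, hypersurfaceQ, ratioMap, Set.mem_ofPred_eq]
  simp only [Matrix.cons_val]
  generalize px (z 0) = x0 at *
  generalize px (z 1) = x1 at *
  generalize px (z 2) = x2 at *
  generalize py (z 0) = y0 at *
  generalize py (z 1) = y1 at *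
  generalize py (z 2) = y2 at *
  refine ⟨?_, ?_, ?_, ?_⟩
  · field_simp
    linear_combination (x1 ^ 3 - x2 ^ 3) * (e0 - e2) - (x0 ^ 3 - x2 ^ 3) * (e1 - e2)
  · intro h
    field_simp at h
    exact h4 h
  · intro h
    field_simp at h
    exact h4 (by linear_combination h + e0 - e2)
  · intro h
    field_simp at h
    refine h4 ?_
    linear_combination h + y2 ^ 2 * e0 - y0 ^ 2 * e2

/-- Equal ratios mean that all x-coordinates differ by one factor ξ and all y-coordinates by one
factor ε. Subtracting the curve equations of the factors 0 and 2 gives (ε² - ξ³)(y₀² - y₂²) = 0, so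
ε² = ξ³, and then the curve equation forces ξ³ = 1. Such a pair (ξ, ε) comes from the group. -/
theorem exists_smul_of_ratioMap_eq {z w : C3} (hz : z ∈ regularLocus) (hw : w ∈ regularLocus)
    (h : ratioMap w = ratioMap z) : ∃ ζ ∈ G, toTorus w = toTorus ((ζ : ℂ) • z) := by
  have hLz := notMem_lattice_of_mem_regularLocus hz
  have hLw := notMem_lattice_of_mem_regularLocus hw
  have a := fun i => py_sq (hLz i)
  have b := fun i => py_sq (hLw i)
  obtain ⟨-, -, z2, z3, z4⟩ := hz
  obtain ⟨-, -, w2, w3, w4⟩ := hw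
  have q0 := congrFun h 0
  have q1 := congrFun h 1
  have q2 := congrFun h 2
  have q3 := congrFun h 3
  simp only [ratioMap] at q0 q1 q2 q3
  simp only [Matrix.cons_val] at q0 q1 q2 q3
  obtain ⟨ξ, hξ⟩ : ∃ ξ, px (w 2) = ξ * px (z 2) := ⟨px (w 2) / px (z 2), by field_simp⟩
  obtain ⟨ε, hε⟩ : ∃ ε, py (w 2) = ε * py (z 2) := ⟨py (w 2) / py (z 2), by field_simp⟩
  have hξ0 : ξ ≠ 0 := by rintro rfl; simp [hξ] at w2
  have hε0 : ε ≠ 0 := by rintro rfl; simp [hε] at w3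
  have y0 : py (w 0) = ε * py (z 0) := by
    rw [hε] at q0; field_simp at q0; linear_combination q0
  have y1 : py (w 1) = ε * py (z 1) := by
    rw [hε] at q1; field_simp at q1; linear_combination q1
  have x0 : px (w 0) = ξ * px (z 0) := by
    rw [hξ] at q2; field_simp at q2; linear_combination q2
  have x1 : px (w 1) = ξ * px (z 1) := by
    rw [hξ] at q3; field_simp at q3; linear_combination q3
  have a0 := a 0
  have a2 := a 2
  have b0 := b 0
  have b2 := b 2
  rw [x0, y0] at b0
  rw [hξ, hε] at b2
  have c : ε ^ 2 = ξ ^ 3 := by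
    have : (ε ^ 2 - ξ ^ 3) * (py (z 0) ^ 2 - py (z 2) ^ 2) = 0 := by
      linear_combination b0 - b2 - ξ ^ 3 * (a0 - a2)
    exact sub_eq_zero.mp ((mul_eq_zero.mp this).resolve_right (sub_ne_zero.mpr z4))
  have hξ3 : ξ ^ 3 = 1 := by
    linear_combination b2 - py (z 2) ^ 2 * c - ξ ^ 3 * a2
  obtain ⟨ζ, hζ, hζ4, hζ3⟩ := exists_mem_G hξ3 (c.trans hξ3)
  refine ⟨ζ, hζ, toTorus_eq_iff.mpr fun i => ?_⟩
  have hn : (ζ : ℂ) * z i ∉ lattice := by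
    intro hm
    have := unit_mul_mem_lattice (G.inv_mem hζ) hm
    exact hLz i (by simpa using this)
  refine sub_mem_lattice_of_eq (hLw i) hn ?_ ?_
  · rw [Pi.smul_apply, smul_eq_mul, px_smul hζ, hζ4]
    fin_cases i
    exacts [x0, x1, hξ]
  · rw [Pi.smul_apply, smul_eq_mul, py_smul hζ, hζ3]
    fin_cases i
    exacts [y0, y1, hε]

/-- The fractions are the solution (X, Y) of Y = X + 1, t²Y = z³X + 1. The remaining equation s²Y =
w³X + 1 is the equation of `Q`. -/
theorem exists_ratioMap_eq {q : Fin 4 → ℂ} (hq : q ∈ regularImage) :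
    ∃ z ∈ regularLocus, ratioMap z = q := by
  obtain ⟨hQ, h0, h1, h2⟩ := hq
  simp only [hypersurfaceQ, Set.mem_ofPred_eq] at hQ
  have h0' := sub_ne_zero.mpr h0
  have h1' := sub_ne_zero.mpr h1
  have h2' := sub_ne_zero.mpr h2
  obtain ⟨x, hx⟩ : ∃ x : ℂ, x ^ 3 = (q 0 ^ 2 - 1) / (q 2 ^ 3 - q 0 ^ 2) :=
    IsAlgClosed.exists_pow_nat_eq _ (by norm_num)
  obtain ⟨y, hy⟩ : ∃ y : ℂ, y ^ 2 = (q 2 ^ 3 - 1) / (q 2 ^ 3 - q 0 ^ 2) :=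
    IsAlgClosed.exists_pow_nat_eq _ (by norm_num)
  have hx0 : x ≠ 0 := by
    rintro rfl
    have : (q 0 ^ 2 - 1) / (q 2 ^ 3 - q 0 ^ 2) ≠ 0 := div_ne_zero h0' h2'
    exact this (by rw [← hx]; simp)
  have hy0 : y ≠ 0 := by
    rintro rfl
    have : (q 2 ^ 3 - 1) / (q 2 ^ 3 - q 0 ^ 2) ≠ 0 := div_ne_zero h1' h2'
    exact this (by rw [← hy]; simp)
  obtain ⟨c, hc, hcx, hcy⟩ : ∃ z ∉ lattice, px z = x ∧ py z = y := exists_px_py (by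
    rw [hx, hy]; field_simp; ring)
  obtain ⟨a, ha, hax, hay⟩ : ∃ z ∉ lattice, px z = q 2 * x ∧ py z = q 0 * y := exists_px_py (by
    rw [mul_pow, mul_pow, hx, hy]; field_simp; ring)
  obtain ⟨b, hb, hbx, hby⟩ : ∃ z ∉ lattice, px z = q 3 * x ∧ py z = q 1 * y := exists_px_py (by
    rw [mul_pow, mul_pow, hx, hy]; field_simp; linear_combination -hQ)
  refine ⟨![a, b, c], ⟨ha, hb, ?_, ?_, ?_⟩, ?_⟩
  · simpa [hcx] using hx0
  · simpa [hcy] using hy0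
  · simp only [Matrix.cons_val, hay, hcy, mul_pow]
    intro h
    exact h0 ((mul_eq_right₀ (pow_ne_zero 2 hy0)).mp h)
  · ext k
    fin_cases k <;> simp [ratioMap, hax, hay, hbx, hby, hcx, hcy, hx0, hy0]

/-- A local analytic right inverse of `ratioMap` over the hypersurface. -/
theorem exists_local_section {z : C3} (hz : z ∈ regularLocus) :
    ∃ Ψ : (Fin 4 → ℂ) → C3, AnalyticAt ℂ Ψ (ratioMap z) ∧ Ψ (ratioMap z) = z ∧
      ∀ᶠ q in 𝓝 (ratioMap z), q ∈ regularImage → ratioMap (Ψ q) = q := by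
  have hL := notMem_lattice_of_mem_regularLocus hz
  have hmem := ratioMap_mem_regularImage hz
  have e0 := py_sq (hL 0)
  have e2 := py_sq (hL 2)
  obtain ⟨-, -, z2, z3, z4⟩ := hz
  set q₀ := ratioMap z with hq₀
  have r0 : q₀ 0 * py (z 2) = py (z 0) := div_mul_cancel₀ _ z3
  have r1 : q₀ 1 * py (z 2) = py (z 1) := div_mul_cancel₀ _ z3
  have r2 : q₀ 2 * px (z 2) = px (z 0) := div_mul_cancel₀ _ z2
  have r3 : q₀ 3 * px (z 2) = px (z 1) := div_mul_cancel₀ _ z2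
  obtain ⟨-, m0, m1, m2⟩ := hmem
  have m2' := sub_ne_zero.mpr m2
  have ev : ∀ i : Fin 4, AnalyticAt ℂ (fun q : Fin 4 → ℂ => q i) q₀ := fun i =>
    (ContinuousLinearMap.proj (R := ℂ) (φ := fun _ : Fin 4 => ℂ) i).analyticAt q₀
  -- the third coordinate is recovered from the value of `px ^ 3`
  have hcube : AnalyticAt ℂ (fun w => px w ^ 3) (z 2) := (analyticAt_px (hL 2)).pow 3
  have hcube' : deriv (fun w => px w ^ 3) (z 2) ≠ 0 := by
    rw [((analyticAt_px (hL 2)).differentiableAt.hasDerivAt.fun_pow 3).deriv]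
    exact mul_ne_zero (mul_ne_zero (by norm_num) (pow_ne_zero _ z2)) (deriv_px_ne_zero z3)
  obtain ⟨φ, hφ, hφ0, hφr⟩ := exists_right_inverse hcube hcube'
  set v : (Fin 4 → ℂ) → ℂ := fun q => (q 0 ^ 2 - 1) / (q 2 ^ 3 - q 0 ^ 2) with hv
  have hva : AnalyticAt ℂ v q₀ :=
    (((ev 0).pow 2).sub analyticAt_const).div (((ev 2).pow 3).sub ((ev 0).pow 2)) m2'
  have hv0 : v q₀ = px (z 2) ^ 3 := by
    rw [hv]
    simp only
    rw [div_eq_iff m2']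
    rw [← r0, ← r2] at e0
    linear_combination e0 - q₀ 0 ^ 2 * e2
  set c : (Fin 4 → ℂ) → ℂ := fun q => φ (v q) with hc
  have hca : AnalyticAt ℂ c q₀ := hφ.comp_of_eq hva hv0
  have hc0 : c q₀ = z 2 := by rw [hc]; simp only [hv0, hφ0]
  have hcx : AnalyticAt ℂ (fun q => px (c q)) q₀ := (analyticAt_px (hL 2)).comp_of_eq hca hc0
  have hcy : AnalyticAt ℂ (fun q => py (c q)) q₀ := (analyticAt_py (hL 2)).comp_of_eq hca hc0
  obtain ⟨ψ, hψ, hψ0, hψr⟩ := exists_local_parameter (hL 0)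
  obtain ⟨χ, hχ, hχ0, hχr⟩ := exists_local_parameter (hL 1)
  -- The ratios force these coordinates on the first two factors. `A` lies on the curve by the
  -- choice of `v`, and `B` does so by the equation of `Q`.
  set A : (Fin 4 → ℂ) → ℂ × ℂ := fun q => (q 2 * px (c q), q 0 * py (c q)) with hA
  set B : (Fin 4 → ℂ) → ℂ × ℂ := fun q => (q 3 * px (c q), q 1 * py (c q)) with hB
  have hAa : AnalyticAt ℂ A q₀ := ((ev 2).mul hcx).prod ((ev 0).mul hcy)
  have hBa : AnalyticAt ℂ B q₀ := ((ev 3).mul hcx).prod ((ev 1).mul hcy)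
  have hA0 : A q₀ = (px (z 0), py (z 0)) := by simp only [hA, hc0, r0, r2]
  have hB0 : B q₀ = (px (z 1), py (z 1)) := by simp only [hB, hc0, r1, r3]
  refine ⟨fun q => ![ψ (A q), χ (B q), c q], ?_, ?_, ?_⟩
  · rw [analyticAt_pi_iff]
    intro k
    fin_cases k
    · exact hψ.comp_of_eq hAa hA0
    · exact hχ.comp_of_eq hBa hB0
    · exact hca
  · ext k
    fin_cases k <;> simp [hA0, hB0, hc0, hψ0, hχ0]
  · have v1 : ∀ᶠ q in 𝓝 q₀, px (c q) ^ 3 = v q := by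
      refine hva.continuousAt.eventually (p := fun x => px (φ x) ^ 3 = x) ?_
      rwa [hv0]
    have v2 : ∀ᶠ q in 𝓝 q₀, c q ∉ lattice :=
      hca.continuousAt.eventually_mem (isOpen_compl_lattice.mem_nhds (by rw [hc0]; exact hL 2))
    have v3 := hcx.continuousAt.eventually_ne (y := 0) (by rwa [hc0])
    have v4 := hcy.continuousAt.eventually_ne (y := 0) (by rwa [hc0])
    have v5 : ∀ᶠ q in 𝓝 q₀, (A q).2 ^ 2 = (A q).1 ^ 3 + 1 →
        px (ψ (A q)) = (A q).1 ∧ py (ψ (A q)) = (A q).2 := by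
      refine hAa.continuousAt.eventually
        (p := fun x => x.2 ^ 2 = x.1 ^ 3 + 1 → px (ψ x) = x.1 ∧ py (ψ x) = x.2) ?_
      rwa [hA0]
    have v6 : ∀ᶠ q in 𝓝 q₀, (B q).2 ^ 2 = (B q).1 ^ 3 + 1 →
        px (χ (B q)) = (B q).1 ∧ py (χ (B q)) = (B q).2 := by
      refine hBa.continuousAt.eventually
        (p := fun x => x.2 ^ 2 = x.1 ^ 3 + 1 → px (χ x) = x.1 ∧ py (χ x) = x.2) ?_
      rwa [hB0]
    filter_upwards [v1, v2, v3, v4, v5, v6] with q w1 w2 w3 w4 w5 w6 hq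
    obtain ⟨hQ, n0, n1, n2⟩ := hq
    simp only [hypersurfaceQ, Set.mem_ofPred_eq] at hQ
    have n2' := sub_ne_zero.mpr n2
    have hy := py_sq w2
    rw [w1] at hy
    simp only [hv] at w1 hy
    obtain ⟨a1, a2⟩ : px (ψ (A q)) = q 2 * px (c q) ∧ py (ψ (A q)) = q 0 * py (c q) := w5 (by
      simp only [hA, mul_pow, w1, hy]; field_simp; ring)
    obtain ⟨b1, b2⟩ : px (χ (B q)) = q 3 * px (c q) ∧ py (χ (B q)) = q 1 * py (c q) := w6 (by
      simp only [hB, mul_pow, w1, hy]; field_simp; linear_combination -hQ)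
    ext k
    fin_cases k <;> simp [ratioMap, a1, a2, b1, b2, w3, w4]

/-! ### Zariski density -/

/-- This is the open mapping theorem, which also covers a = 0, where the derivative may vanish. -/
theorem map_nhds_pow_sub_one {n : ℕ} (hn : n ≠ 0) (a : ℂ) :
    𝓝 (a ^ n - 1) ≤ Filter.map (fun x : ℂ => x ^ n - 1) (𝓝 a) := by
  have ha : AnalyticAt ℂ (fun x : ℂ => x ^ n - 1) a := by fun_prop
  refine ha.eventually_constant_or_nhds_le_map_nhds.resolve_left fun h => ?_
  have hF : AnalyticOnNhd ℂ (fun x : ℂ => x ^ n - 1) Set.univ := fun x _ => by fun_prop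
  have hG : AnalyticOnNhd ℂ (fun _ : ℂ => a ^ n - 1) Set.univ := fun x _ => by fun_prop
  have he := hF.eq_of_eventuallyEq hG h
  have h01 : (0 : ℂ) ^ n - 1 = 1 ^ n - 1 := (congrFun he 0).trans (congrFun he 1).symm
  simp [hn] at h01

/-- Two proportional vectors in the plane are multiples of a common vector. -/
theorem exists_common_vector {a b c d : ℂ} (h : c * b = a * d) :
    ∃ l m v w : ℂ, a = l * v ∧ b = l * w ∧ c = m * v ∧ d = m * w := by
  by_cases ha : a = 0
  · by_cases hb : b = 0
    · exact ⟨0, 1, c, d, by simp [ha], by simp [hb], by simp, by simp⟩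
    · exact ⟨1, d / b, a, b, by simp, by simp, by
        field_simp; linear_combination h, by field_simp⟩
  · exact ⟨1, c / a, a, b, by simp, by simp, by field_simp, by field_simp; linear_combination -h⟩

theorem eventually_add_mul_ne_zero (x : ℂ) {k : ℂ} (hk : k ≠ 0) :
    ∀ᶠ ε in 𝓝[≠] (0 : ℂ), x + k * ε ≠ 0 := by
  by_cases hx : x = 0
  · filter_upwards [self_mem_nhdsWithin] with ε hε
    simpa [hx, hk] using hε
  · have : ContinuousAt (fun ε : ℂ => x + k * ε) 0 := by fun_prop
    exact (this.eventually_ne (by simpa using hx)).filter_mono nhdsWithin_le_nhds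

/-- The equation says that the 2 × 2 matrix with rows (z³ - 1, t² - 1) and (w³ - 1, s² - 1) is an
outer product of (l, m) and (v, w). Perturbing these vectors preserves the equation, and openness of
x ↦ xⁿ - 1 lifts the perturbation to the coordinates. -/
theorem hypersurfaceQ_subset_closure : hypersurfaceQ ⊆ closure regularImage := by
  intro q hq
  rw [mem_closure_iff_nhds]
  intro N hN
  simp only [hypersurfaceQ, Set.mem_ofPred_eq] at hq
  obtain ⟨l, m, v, w, h2, h0, h3, h1⟩ := exists_common_vector hq
  -- a product of neighbourhoods of the coordinates
  rw [nhds_pi, Filter.mem_pi] at hN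
  obtain ⟨I, -, t, ht, htN⟩ := hN
  have key : ∀ (i : Fin 4) (n : ℕ), n ≠ 0 → ∀ f : ℂ → ℂ, ContinuousAt f 0 → q i ^ n - 1 = f 0 →
      ∀ᶠ ε in 𝓝[≠] (0 : ℂ), ∃ x ∈ t i, x ^ n - 1 = f ε := by
    intro i n hn f hf h
    have h' : (fun x : ℂ => x ^ n - 1) '' t i ∈ 𝓝 (f 0) := by
      rw [← h]
      exact map_nhds_pow_sub_one hn (q i) (Filter.image_mem_map (ht i))
    exact (hf.eventually_mem h').filter_mono nhdsWithin_le_nhds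
  -- The increments ε and 2ε of `v` and `w` differ so that v - w moves too: z³ - t² becomes (l +
  -- ε)(v - w - ε). No inequality involves `m`, which stays fixed.
  have k0 := key 0 2 two_ne_zero (fun ε => (l + ε) * (w + 2 * ε)) (by fun_prop) (by simp [h0])
  have k1 := key 1 2 two_ne_zero (fun ε => m * (w + 2 * ε)) (by fun_prop) (by simp [h1])
  have k2 := key 2 3 three_ne_zero (fun ε => (l + ε) * (v + ε)) (by fun_prop) (by simp [h2])
  have k3 := key 3 3 three_ne_zero (fun ε => m * (v + ε)) (by fun_prop) (by simp [h3])
  have n1 := eventually_add_mul_ne_zero l one_ne_zero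
  have n2 := eventually_add_mul_ne_zero v one_ne_zero
  have n3 := eventually_add_mul_ne_zero w two_ne_zero
  have n4 := eventually_add_mul_ne_zero (v - w) (neg_ne_zero.mpr one_ne_zero)
  obtain ⟨ε, ⟨x0, t0, e0⟩, ⟨x1, t1, e1⟩, ⟨x2, t2, e2⟩, ⟨x3, t3, e3⟩, m1, m2, m3, m4⟩ :=
    (k0.and (k1.and (k2.and (k3.and (n1.and (n2.and (n3.and n4))))))).exists
  rw [one_mul] at m1 m2
  refine ⟨![x0, x1, x2, x3], htN fun i _ => ?_, ?_, ?_, ?_, ?_⟩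
  · fin_cases i
    exacts [t0, t1, t2, t3]
  · simp only [hypersurfaceQ, Set.mem_ofPred_eq, Matrix.cons_val]
    rw [e0, e1, e2, e3]
    ring
  · simp only [Matrix.cons_val]
    rw [← sub_ne_zero, e0]
    exact mul_ne_zero m1 m3
  · simp only [Matrix.cons_val]
    rw [← sub_ne_zero, e2]
    exact mul_ne_zero m1 m2
  · simp only [Matrix.cons_val]
    rw [← sub_ne_zero, ← sub_sub_sub_cancel_right _ _ 1, e0, e2]
    have := mul_ne_zero m1 m4
    intro h
    exact this (by linear_combination h)

theorem isZariskiDenseOpen_regularImage : IsZariskiDenseOpen hypersurfaceQ regularImage := by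
  constructor
  · refine ⟨{(MvPolynomial.X 0 ^ 2 - 1) * (MvPolynomial.X 2 ^ 3 - 1)
      * (MvPolynomial.X 2 ^ 3 - MvPolynomial.X 0 ^ 2)}, ?_⟩
    ext q
    simp [regularImage, sub_eq_zero, not_or, and_assoc]
  · intro P hP q hq
    have hc : Continuous fun q => MvPolynomial.eval q P := MvPolynomial.continuous_eval P
    have hcl : IsClosed {q | MvPolynomial.eval q P = 0} := isClosed_eq hc continuous_const
    exact hcl.closure_subset_iff.mpr hP (hypersurfaceQ_subset_closure hq)

/-! ### Density of the regular locus -/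

theorem countable_fibre (x y : ℂ) : {c : ℂ | c ∉ lattice ∧ px c = x ∧ py c = y}.Countable := by
  rcases Set.eq_empty_or_nonempty {c : ℂ | c ∉ lattice ∧ px c = x ∧ py c = y} with h | ⟨a, ha⟩
  · rw [h]; exact Set.countable_empty
  · refine (countable_lattice.preimage (sub_left_injective (b := a))).mono ?_
    rintro c ⟨h1, h2, h3⟩
    exact sub_mem_lattice_of_eq ha.1 h1 (ha.2.1.trans h2.symm) (ha.2.2.trans h3.symm)

theorem countable_py_sq_eq (y : ℂ) : {c : ℂ | c ∈ lattice ∨ py c ^ 2 = y}.Countable := by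
  have hf : ∀ (n : ℕ) (k : ℂ), 0 < n → {a : ℂ | a ^ n = k}.Countable := by
    intro n k hn
    refine ((Polynomial.nthRoots n k).toFinset.countable_toSet).mono fun a ha => ?_
    simpa [Polynomial.mem_nthRoots hn] using ha
  have : {c : ℂ | c ∈ lattice ∨ py c ^ 2 = y} ⊆ (lattice : Set ℂ) ∪
      ⋃ a ∈ {a : ℂ | a ^ 3 = y - 1}, ⋃ b ∈ {b : ℂ | b ^ 2 = y},
        {c : ℂ | c ∉ lattice ∧ px c = a ∧ py c = b} := by
    intro c hc
    by_cases hl : c ∈ lattice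
    · exact Or.inl hl
    · have hy := hc.resolve_left hl
      have := py_sq hl
      simp only [Set.mem_union, Set.mem_iUnion]
      exact Or.inr ⟨px c, by simp only [Set.mem_ofPred_eq]; linear_combination hy - this,
        py c, hy, hl, rfl, rfl⟩
  refine Set.Countable.mono this (countable_lattice.union ?_)
  exact (hf 3 _ (by norm_num)).biUnion fun a _ => (hf 2 _ (by norm_num)).biUnion fun b _ =>
    countable_fibre a b

/-- Choosing the coordinates in the order 2, 0, 1, each has only countably many values to avoid. The
condition px ≠ 0 is expressed as py² ≠ 1. -/
theorem dense_regularLocus : Dense regularLocus := by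
  intro z
  rw [mem_closure_iff_nhds]
  intro N hN
  rw [nhds_pi, Filter.mem_pi] at hN
  obtain ⟨I, -, t, ht, htN⟩ := hN
  have key : ∀ (i : Fin 3) {s : Set ℂ}, s.Countable → ∃ c ∈ t i, c ∉ s := fun i s hs => by
    obtain ⟨c, h1, h2⟩ := mem_closure_iff_nhds.mp (hs.dense_compl ℂ (z i)) (t i) (ht i)
    exact ⟨c, h1, h2⟩
  obtain ⟨c, hc, hc'⟩ := key 2 ((countable_py_sq_eq 0).union (countable_py_sq_eq 1))
  obtain ⟨a, ha, ha'⟩ := key 0 (countable_py_sq_eq (py c ^ 2))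
  obtain ⟨b, hb, hb'⟩ := key 1 countable_lattice
  simp only [Set.mem_union, Set.mem_ofPred_eq, not_or] at hc' ha'
  obtain ⟨⟨hcL, hc0⟩, -, hc1⟩ := hc'
  refine ⟨![a, b, c], htN fun i _ => ?_, ha'.1, hb', ?_, ?_, ha'.2⟩
  · fin_cases i
    exacts [ha, hb, hc]
  · intro h
    have h : px c = 0 := h
    exact hc1 (by rw [py_sq hcL, h]; norm_num)
  · intro h
    have h : py c = 0 := h
    exact hc0 (by rw [h]; norm_num)

/-! ### The blow-up away from the exceptional divisors -/

theorem eq_mk_of_mem_submodule {ℓ : ℙ ℂ C3} {v : C3} (hv : v ≠ 0) (h : v ∈ ℓ.submodule) :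
    ℓ = Projectivization.mk ℂ v hv := by
  rw [Projectivization.submodule_eq, Submodule.mem_span_singleton] at h
  obtain ⟨a, ha⟩ := h
  rw [← ℓ.mk_rep, eq_comm, Projectivization.mk_eq_mk_iff']
  exact ⟨a, ha⟩

theorem tendsto_mk {ι : Type*} {l : Filter ι} {f : ι → C3} {v : C3} (hf : ∀ i, f i ≠ 0)
    (hv : v ≠ 0) (h : Filter.Tendsto f l (𝓝 v)) :
    Filter.Tendsto (fun i => Projectivization.mk ℂ (f i) (hf i)) l
      (𝓝 (Projectivization.mk ℂ v hv)) := by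
  have hc : Continuous (Projectivization.mk' ℂ : {v : C3 // v ≠ 0} → ℙ ℂ C3) :=
    continuous_quotient_mk'
  have ht : Filter.Tendsto (fun i => (⟨f i, hf i⟩ : {v : C3 // v ≠ 0})) l (𝓝 ⟨v, hv⟩) :=
    tendsto_subtype_rng.mpr h
  exact (hc.tendsto ⟨v, hv⟩).comp ht

namespace BlowUp

theorem continuous_z : Continuous BlowUp.z :=
  continuous_fst.comp (continuous_induced_dom (f := fun x : BlowUp => (x.z, x.line)))

theorem sub_ne_zero_of_notMem {z : C3} (hz : z ∉ fixedPoints) (p : fixedPoints) :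
    z - (p : C3) ≠ 0 := by
  intro h
  rw [sub_eq_zero.mp h] at hz
  exact hz p.2

/-- The point of the blow-up over a point that is not blown up. -/
def ofNotMem (z : C3) (hz : z ∉ fixedPoints) : BlowUp where
  z := z
  line p := Projectivization.mk ℂ (z - (p : C3)) (sub_ne_zero_of_notMem hz p)
  incident p := by
    rw [Projectivization.submodule_mk]
    exact Submodule.mem_span_singleton_self _

theorem eq_ofNotMem (x : BlowUp) (hx : x.z ∉ fixedPoints) : x = ofNotMem x.z hx := by
  ext1
  · rfl
  · funext p
    exact eq_mk_of_mem_submodule _ (x.incident p)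

theorem tendsto_iff {ι : Type*} {l : Filter ι} {f : ι → BlowUp} {x : BlowUp} :
    Filter.Tendsto f l (𝓝 x) ↔ Filter.Tendsto (fun i => (f i).z) l (𝓝 x.z) ∧
      ∀ p, Filter.Tendsto (fun i => (f i).line p) l (𝓝 (x.line p)) := by
  rw [nhds_induced, Filter.tendsto_comap_iff, nhds_prod_eq, Filter.tendsto_prod_iff']
  exact and_congr Iff.rfl tendsto_pi_nhds

theorem tendsto_ofNotMem {ι : Type*} {l : Filter ι} {f : ι → C3} (hf : ∀ i, f i ∉ fixedPoints)
    {z : C3} (hz : z ∉ fixedPoints) (h : Filter.Tendsto f l (𝓝 z)) :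
    Filter.Tendsto (fun i => ofNotMem (f i) (hf i)) l (𝓝 (ofNotMem z hz)) :=
  tendsto_iff.mpr ⟨h, fun _ => tendsto_mk _ _ (h.sub_const _)⟩

/-- A point over `p` with line [v₀] is the limit of the points over p + εv as ε → 0 and v → v₀,
because their line at `p` is [εv] = [v]. The lines at other centres vary continuously. -/
theorem dense_preimage_regularLocus : Dense (BlowUp.z ⁻¹' regularLocus) := by
  intro x
  obtain ⟨v₀, hv₀⟩ : ∃ v₀ : C3, ∀ p : fixedPoints, (p : C3) = x.z →
      ∃ h : v₀ ≠ 0, x.line p = Projectivization.mk ℂ v₀ h := by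
    by_cases hx : x.z ∈ fixedPoints
    · refine ⟨(x.line ⟨x.z, hx⟩).rep, fun p hp => ?_⟩
      obtain rfl : p = ⟨x.z, hx⟩ := Subtype.ext hp
      exact ⟨Projectivization.rep_nonzero _, (Projectivization.mk_rep _).symm⟩
    · exact ⟨0, fun p hp => absurd (hp ▸ p.2) hx⟩
  set T : Set (ℂ × C3) := {t | t.1 ≠ 0 ∧ x.z + t.1 • t.2 ∈ regularLocus} with hT
  -- For fixed ε ≠ 0, v ↦ x.z + εv is a homeomorphism, so density of the regular locus supplies v
  -- near v₀.
  have hcl : ((0 : ℂ), v₀) ∈ closure T := by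
    rw [mem_closure_iff_nhds]
    intro N hN
    rw [nhds_prod_eq, Filter.mem_prod_iff] at hN
    obtain ⟨A, hA, B, hB, hAB⟩ := hN
    obtain ⟨ε, hεA, hε⟩ : ∃ ε ∈ A, ε ≠ 0 := by
      have : A ∈ 𝓝[≠] (0 : ℂ) := nhdsWithin_le_nhds hA
      obtain ⟨ε, h1, h2⟩ := Filter.nonempty_of_mem (Filter.inter_mem this self_mem_nhdsWithin)
      exact ⟨ε, h1, h2⟩
    have hd : Dense ((fun v : C3 => x.z + ε • v) ⁻¹' regularLocus) :=
      dense_regularLocus.preimage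
        ((Homeomorph.smulOfNeZero ε hε).trans (Homeomorph.addLeft x.z)).isOpenMap
    obtain ⟨v, hvB, hv⟩ := mem_closure_iff_nhds.mp (hd v₀) B hB
    exact ⟨(ε, v), hAB ⟨hεA, hvB⟩, hε, hv⟩
  have hne : (Filter.comap (Subtype.val : T → ℂ × C3) (𝓝 ((0 : ℂ), v₀))).NeBot :=
    mem_closure_iff_comap_neBot.mp hcl
  have hfix : ∀ t : T, x.z + t.1.1 • t.1.2 ∉ fixedPoints := fun t =>
    notMem_fixedPoints_of_mem_regularLocus t.2.2
  have h1 : Filter.Tendsto (fun t : T => t.1.1) (Filter.comap Subtype.val (𝓝 ((0 : ℂ), v₀)))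
      (𝓝 0) := (continuous_fst.tendsto _).comp Filter.tendsto_comap
  have h2 : Filter.Tendsto (fun t : T => t.1.2) (Filter.comap Subtype.val (𝓝 ((0 : ℂ), v₀)))
      (𝓝 v₀) := (continuous_snd.tendsto _).comp Filter.tendsto_comap
  have h3 : Filter.Tendsto (fun t : T => x.z + t.1.1 • t.1.2)
      (Filter.comap Subtype.val (𝓝 ((0 : ℂ), v₀))) (𝓝 x.z) := by
    simpa using (h1.smul h2).const_add x.z
  refine mem_closure_of_tendsto (f := fun t : T => ofNotMem _ (hfix t))
    (b := Filter.comap Subtype.val (𝓝 ((0 : ℂ), v₀))) (tendsto_iff.mpr ⟨h3, fun p => ?_⟩)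
    (Filter.Eventually.of_forall fun t => t.2.2)
  by_cases hp : (p : C3) = x.z
  · obtain ⟨hv, hl⟩ := hv₀ p hp
    have hn : ∀ t : T, t.1.2 ≠ 0 := by
      intro t h0
      refine hfix t ?_
      rw [h0, smul_zero, add_zero, ← hp]
      exact p.2
    rw [hl]
    refine (tendsto_mk hn hv h2).congr fun t => ?_
    rw [ofNotMem]
    simp only
    rw [eq_comm, Projectivization.mk_eq_mk_iff']
    exact ⟨t.1.1, by rw [hp]; simp⟩
  · have hs : x.z - (p : C3) ≠ 0 := sub_ne_zero.mpr (Ne.symm hp)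
    rw [eq_mk_of_mem_submodule hs (x.incident p)]
    exact tendsto_mk _ _ (h3.sub_const _)

end BlowUp

/-! ### The quotient -/

theorem Y.isQuotientMap_mk : Topology.IsQuotientMap Y.mk := isQuotientMap_quot_mk

theorem Y.continuous_mk : Continuous Y.mk := Y.isQuotientMap_mk.continuous

theorem Y.mk_surjective : Function.Surjective Y.mk := Quotient.mk_surjective

/-- Off the blown up points every line is spanned by z - p, and scalars preserve lines, so the
condition on lines is automatic. -/
theorem Y.mk_eq_of_notMem {x y : BlowUp} (hx : x.z ∉ fixedPoints) {ζ : ℂˣ} (hζ : ζ ∈ G)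
    (h : toTorus y.z = toTorus ((ζ : ℂ) • x.z)) : Y.mk x = Y.mk y := by
  refine Quotient.sound ⟨ζ, hζ, h, fun p p' hp => ?_⟩
  have h1 : x.z - (p : C3) ≠ 0 := BlowUp.sub_ne_zero_of_notMem hx p
  have e : y.z - (p' : C3) = (ζ : ℂ) • (x.z - (p : C3)) := by
    rw [hp, ← neg_sub (p : C3) x.z, smul_neg]
    abel
  have h2 : y.z - (p' : C3) ≠ 0 := by
    rw [e]
    exact smul_ne_zero ζ.ne_zero h1
  rw [eq_mk_of_mem_submodule h1 (x.incident p), eq_mk_of_mem_submodule h2 (y.incident p'),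
    Projectivization.mk_eq_mk_iff']
  exact ⟨ζ, e.symm⟩

/-- A function on `ℂ³` that is invariant under the affine maps that induce `diag(ζ, ζ, ζ)` on
`E_ω³`, with `ζ ∈ ⟨-ω⟩`. -/
def IsInvariant {α : Sort*} (f : C3 → α) : Prop :=
  ∀ ζ ∈ G, ∀ z w : C3, toTorus w = toTorus ((ζ : ℂ) • z) → f w = f z

/-- The function on `Y` induced by an invariant function on `ℂ³`. -/
def Y.lift {α : Sort*} (f : C3 → α) (hf : IsInvariant f) : Y → α :=
  Quotient.lift (fun x : BlowUp => f x.z) fun x y h => by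
    obtain ⟨ζ, hζ, hT, -⟩ := h
    exact (hf ζ hζ _ _ hT).symm

theorem Y.lift_mk {α : Sort*} (f : C3 → α) (hf : IsInvariant f) (x : BlowUp) :
    Y.lift f hf (Y.mk x) = f x.z := rfl

theorem isInvariant_regularLocus : IsInvariant (· ∈ regularLocus) := fun _ hζ _ _ h =>
  propext (regularLocus_iff_of_toTorus_eq hζ h)

theorem isInvariant_ratioMap : IsInvariant ratioMap := fun _ hζ _ _ h => ratioMap_of_toTorus_eq hζ h

/-- A function that is locally an analytic function of `z` is holomorphic on the blow-up. -/
theorem BlowUp.holAt_of_analyticAt {f : BlowUp → ℂ} {F : C3 → ℂ} {x : BlowUp}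
    (hF : AnalyticAt ℂ F x.z) (h : ∀ᶠ y in 𝓝 x, f y = F y.z) : BlowUp.HolAt f x := by
  by_cases hx : x.z ∈ fixedPoints
  · right
    obtain ⟨i, hi⟩ := Function.ne_iff.mp (x.line ⟨x.z, hx⟩).rep_nonzero
    exact ⟨⟨x.z, hx⟩, rfl, i, hi, fun q => F q.1, hF.comp_of_eq analyticAt_fst rfl, h⟩
  · exact Or.inl ⟨hx, F, hF, h⟩

/-- The open subset of `Y` over the regular locus. -/
def regularY : Set Y := {y | Y.lift (· ∈ regularLocus) isInvariant_regularLocus y}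

theorem mk_mem_regularY {x : BlowUp} : Y.mk x ∈ regularY ↔ x.z ∈ regularLocus := Iff.rfl

theorem isOpen_regularY : IsOpen regularY :=
  Y.isQuotientMap_mk.isOpen_preimage.mp (isOpen_regularLocus.preimage BlowUp.continuous_z)

theorem dense_regularY : Dense regularY := by
  refine (Y.mk_surjective.denseRange.dense_image Y.continuous_mk
    BlowUp.dense_preimage_regularLocus).mono ?_
  rintro _ ⟨x, hx, rfl⟩
  exact hx

/-! ### The isomorphism with the open subset of the hypersurface -/

/-- The map from `Y` to `𝔸⁴` induced by `ratioMap`. -/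
def Y.ratio : Y → Fin 4 → ℂ := Y.lift ratioMap isInvariant_ratioMap

theorem continuousOn_ratio : ContinuousOn Y.ratio regularY := by
  rw [Y.isQuotientMap_mk.continuousOn_isOpen_iff isOpen_regularY]
  intro x hx
  exact ((analyticAt_ratioMap hx).continuousAt.comp_of_eq BlowUp.continuous_z.continuousAt
    rfl).continuousWithinAt

theorem ratio_mem {y : Y} (hy : y ∈ regularY) : Y.ratio y ∈ regularImage := by
  obtain ⟨x, rfl⟩ := Y.mk_surjective y
  exact ratioMap_mem_regularImage hy

/-- The map `regularY → regularImage`. -/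
def ratioRestrict (y : regularY) : regularImage := ⟨Y.ratio y, ratio_mem y.2⟩

theorem continuous_ratioRestrict : Continuous ratioRestrict :=
  Continuous.subtype_mk continuousOn_ratio.domRestrict _

/-- The point of `Y` over a point of the regular locus. -/
def Y.ofRegular (z : C3) (hz : z ∈ regularLocus) : Y :=
  Y.mk (BlowUp.ofNotMem z (notMem_fixedPoints_of_mem_regularLocus hz))

theorem bijective_ratioRestrict : Function.Bijective ratioRestrict := by
  constructor
  · rintro ⟨a, ha⟩ ⟨b, hb⟩ h
    obtain ⟨x, rfl⟩ := Y.mk_surjective a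
    obtain ⟨y, rfl⟩ := Y.mk_surjective b
    obtain ⟨ζ, hζ, hT⟩ := exists_smul_of_ratioMap_eq ha hb (Subtype.ext_iff.mp h).symm
    exact Subtype.ext (Y.mk_eq_of_notMem (notMem_fixedPoints_of_mem_regularLocus ha) hζ hT)
  · rintro ⟨q, hq⟩
    obtain ⟨z, hz, rfl⟩ := exists_ratioMap_eq hq
    exact ⟨⟨Y.ofRegular z hz, hz⟩, rfl⟩

/-- `ratioRestrict` as an equivalence. -/
def ratioEquiv : regularY ≃ regularImage := Equiv.ofBijective _ bijective_ratioRestrict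

/-- The inverse of `ratioEquiv` is locally given by an analytic map to `ℂ³`. -/
theorem exists_local_inverse {x : BlowUp} (hx : x.z ∈ regularLocus) :
    ∃ Ψ : (Fin 4 → ℂ) → C3, AnalyticAt ℂ Ψ (ratioMap x.z) ∧ Ψ (ratioMap x.z) = x.z ∧
      ∃ σ : regularImage → BlowUp,
        Filter.Tendsto σ (𝓝 (ratioEquiv ⟨Y.mk x, hx⟩)) (𝓝 x) ∧
        ∀ᶠ q in 𝓝 (ratioEquiv ⟨Y.mk x, hx⟩),
          (σ q).z = Ψ q ∧ (ratioEquiv.symm q : Y) = Y.mk (σ q) := by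
  classical
  obtain ⟨Ψ, hΨ, hΨ0, hΨr⟩ := exists_local_section hx
  refine ⟨Ψ, hΨ, hΨ0, ?_⟩
  set q₀ : regularImage := ratioEquiv ⟨Y.mk x, hx⟩ with hq₀
  have hval : Filter.Tendsto (Subtype.val : regularImage → Fin 4 → ℂ) (𝓝 q₀)
      (𝓝 (ratioMap x.z)) := continuous_subtype_val.tendsto q₀
  have hfix := notMem_fixedPoints_of_mem_regularLocus hx
  -- The fallback value x.z makes the section total; near q₀ it is never used.
  set g : regularImage → C3 := fun q => if Ψ q ∈ regularLocus then Ψ q else x.z with hg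
  have hgr : ∀ q, g q ∈ regularLocus := by
    intro q
    simp only [hg]
    split_ifs with h
    · exact h
    · exact hx
  have hΨt : Filter.Tendsto (fun q : regularImage => Ψ q) (𝓝 q₀) (𝓝 x.z) := by
    have := hΨ.continuousAt.tendsto.comp hval
    rwa [hΨ0] at this
  have hgΨ : ∀ᶠ q in 𝓝 q₀, g q = Ψ q := by
    filter_upwards [hΨt.eventually_mem (isOpen_regularLocus.mem_nhds hx)] with q hq
    exact if_pos hq
  have hgt : Filter.Tendsto g (𝓝 q₀) (𝓝 x.z) := hΨt.congr' (hgΨ.mono fun _ h => h.symm)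
  refine ⟨fun q => BlowUp.ofNotMem (g q) (notMem_fixedPoints_of_mem_regularLocus (hgr q)), ?_, ?_⟩
  · rw [x.eq_ofNotMem hfix]
    exact BlowUp.tendsto_ofNotMem _ hfix hgt
  · filter_upwards [hgΨ, hval.eventually hΨr] with q h1 h2
    refine ⟨h1, ?_⟩
    have : ratioEquiv.symm q = ⟨Y.ofRegular (g q) (hgr q), hgr q⟩ := by
      rw [Equiv.symm_apply_eq]
      refine Subtype.ext ?_
      change (q : Fin 4 → ℂ) = ratioMap (g q)
      rw [h1, h2 q.2]
    rw [this]
    rfl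

theorem continuous_ratioEquiv_symm : Continuous ratioEquiv.symm := by
  rw [continuous_iff_continuousAt]
  intro q
  obtain ⟨⟨y, hy⟩, rfl⟩ := ratioEquiv.surjective q
  obtain ⟨x, rfl⟩ := Y.mk_surjective y
  obtain ⟨Ψ, -, -, σ, hσ, hev⟩ := exists_local_inverse (x := x) hy
  rw [ContinuousAt, Equiv.symm_apply_apply, tendsto_subtype_rng]
  refine ((Y.continuous_mk.tendsto x).comp hσ).congr' ?_
  filter_upwards [hev] with q hq using hq.2.symm

/-- The isomorphism of `regularY` with `regularImage`. -/
def ratioHomeomorph : regularY ≃ₜ regularImage where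
  toEquiv := ratioEquiv
  continuous_toFun := continuous_ratioRestrict
  continuous_invFun := continuous_ratioEquiv_symm

/-- A holomorphic function is locally H(z), and z = Ψ(q) turns it into H ∘ Ψ; conversely F(q) pulls
back along `ratioMap`. -/
theorem holAt_iff (u : regularY) (h : Y → ℂ) : Y.HolAt h u ↔
    ∃ F : (Fin 4 → ℂ) → ℂ, AnalyticAt ℂ F (ratioHomeomorph u : Fin 4 → ℂ) ∧
      ∀ᶠ u' : regularY in 𝓝 u, h (u' : Y) = F (ratioHomeomorph u' : Fin 4 → ℂ) := by
  obtain ⟨y, hy⟩ := u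
  constructor
  · intro hol
    obtain ⟨x, rfl⟩ := Y.mk_surjective y
    have hx : x.z ∈ regularLocus := hy
    obtain ⟨H, hH, hev⟩ : ∃ H : C3 → ℂ, AnalyticAt ℂ H x.z ∧ ∀ᶠ y in 𝓝 x, h (Y.mk y) = H y.z := by
      rcases hol x rfl with ⟨-, h'⟩ | ⟨p, hp, -⟩
      · exact h'
      · exact absurd (hp ▸ p.2) (notMem_fixedPoints_of_mem_regularLocus hx)
    obtain ⟨Ψ, hΨ, hΨ0, σ, hσ, hσev⟩ := exists_local_inverse (x := x) hx
    refine ⟨fun q => H (Ψ q), hH.comp_of_eq hΨ hΨ0, ?_⟩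
    have ht : Filter.Tendsto ratioHomeomorph (𝓝 ⟨Y.mk x, hy⟩) (𝓝 (ratioEquiv ⟨Y.mk x, hx⟩)) :=
      ratioHomeomorph.continuous.tendsto _
    filter_upwards [ht.eventually hσev, ht.eventually (hσ.eventually hev)] with u h1 h2
    have h3 : (u : Y) = Y.mk (σ (ratioHomeomorph u)) := by
      rw [← h1.2]
      exact congrArg Subtype.val (ratioEquiv.symm_apply_apply u).symm
    rw [h3, h2, h1.1]
  · rintro ⟨F, hF, hev⟩ x hxy
    subst hxy
    have hx : x.z ∈ regularLocus := hy
    refine BlowUp.holAt_of_analyticAt (F := fun z => F (ratioMap z))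
      (hF.comp_of_eq (analyticAt_ratioMap hx) rfl) ?_
    rw [nhds_subtype_eq_comap, Filter.eventually_comap] at hev
    have ht := Y.continuous_mk.tendsto x
    filter_upwards [ht.eventually hev, ht.eventually_mem (isOpen_regularY.mem_nhds hy)] with x' h1 h2
    exact h1 ⟨Y.mk x', h2⟩ rfl

/-! ### Homogeneous coordinates near the poles -/

/-- `p` is an elliptic function with poles exactly at the lattice points, on which `ζ ∈ ⟨-ω⟩` acts
through multiplication by the `k`-th root of unity `χ ζ`; its value at the poles is `0`. -/
structure IsSemiInvariant (p : ℂ → ℂ) (k : ℕ) (χ : ℂˣ → ℂ) : Prop where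
  analyticAt : ∀ z ∉ lattice, AnalyticAt ℂ p z
  pole : ∀ l ∈ lattice, AnalyticAt ℂ (fun z => (p z)⁻¹) l ∧ ∀ᶠ z in 𝓝 l, z ≠ l → p z ≠ 0
  eq_zero : ∀ l ∈ lattice, p l = 0
  weight_ne_zero : k ≠ 0
  pow_eq_one : ∀ ζ ∈ G, χ ζ ^ k = 1
  smul : ∀ ζ ∈ G, ∀ z w : C3, toTorus w = toTorus ((ζ : ℂ) • z) → ∀ i, p (w i) = χ ζ * p (z i)

theorem isSemiInvariant_px : IsSemiInvariant px 3 (fun ζ => (ζ : ℂ) ^ 4) where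
  analyticAt _ := analyticAt_px
  pole _ := px_pole
  eq_zero _ := px_of_mem
  weight_ne_zero := three_ne_zero
  pow_eq_one ζ hζ := by linear_combination ((ζ : ℂ) ^ 6 + 1) * pow_six_of_mem_G hζ
  smul _ hζ _ _ := px_of_toTorus_eq hζ

theorem isSemiInvariant_py : IsSemiInvariant py 2 (fun ζ => (ζ : ℂ) ^ 3) where
  analyticAt _ := analyticAt_py
  pole _ := py_pole
  eq_zero _ := py_of_mem
  weight_ne_zero := two_ne_zero
  pow_eq_one ζ hζ := by linear_combination pow_six_of_mem_G hζ
  smul _ hζ _ _ := py_of_toTorus_eq hζ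

/-- Homogeneous coordinates `[f : g]` of `p`, analytic on an open set `N` that is invariant under
the group. -/
structure IsHomogeneousChart (p : ℂ → ℂ) (k : ℕ) (χ : ℂˣ → ℂ) (N : Set ℂ) (f g : ℂ → ℂ) :
    Prop where
  isOpen : IsOpen N
  analyticAt_fst : ∀ z ∈ N, AnalyticAt ℂ f z
  analyticAt_snd : ∀ z ∈ N, AnalyticAt ℂ g z
  ne_zero : ∀ z ∈ N, z ∉ lattice → g z ≠ 0
  eq_mul : ∀ z ∈ N, z ∉ lattice → f z = p z * g z
  eq_zero : ∀ z ∈ N, z ∈ lattice → g z = 0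
  mem_iff : ∀ ζ ∈ G, ∀ z w : C3, toTorus w = toTorus ((ζ : ℂ) • z) → ∀ i, (w i ∈ N ↔ z i ∈ N)
  smul : ∀ ζ ∈ G, ∀ z w : C3, toTorus w = toTorus ((ζ : ℂ) • z) → ∀ i a b, a + b = k →
    f (w i) ^ a * g (w i) ^ b = χ ζ ^ a * (f (z i) ^ a * g (z i) ^ b)

/-- The charts are [1 : 1/p] around the lattice and [p : 1] off it. The default value p = 0 at the
poles gives 1/p its correct value 0 there. -/
theorem IsSemiInvariant.exists_chart {p : ℂ → ℂ} {k : ℕ} {χ : ℂˣ → ℂ}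
    (hp : IsSemiInvariant p k χ) (c : ℂ) :
    ∃ (N : Set ℂ) (f g : ℂ → ℂ), c ∈ N ∧ IsHomogeneousChart p k χ N f g := by
  by_cases hc : c ∈ lattice
  · refine ⟨{z | z ∈ lattice ∨ p z ≠ 0}, fun _ => 1, fun z => (p z)⁻¹, Or.inl hc, ?_⟩
    constructor
    · rw [isOpen_iff_mem_nhds]
      intro z hz
      by_cases hl : z ∈ lattice
      · filter_upwards [(hp.pole z hl).2] with w hw
        by_cases h : w = z
        · exact Or.inl (h ▸ hl)
        · exact Or.inr (hw h)
      · filter_upwards [(hp.analyticAt z hl).continuousAt.eventually_ne (hz.resolve_left hl)]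
          with w hw
        exact Or.inr hw
    · exact fun _ _ => analyticAt_const
    · intro z hz
      by_cases hl : z ∈ lattice
      · exact (hp.pole z hl).1
      · exact (hp.analyticAt z hl).inv (hz.resolve_left hl)
    · exact fun z hz hl => inv_ne_zero (hz.resolve_left hl)
    · exact fun z hz hl => (mul_inv_cancel₀ (hz.resolve_left hl)).symm
    · exact fun z _ hl => by rw [hp.eq_zero z hl, inv_zero]
    · intro ζ hζ z w h i
      have hχ : χ ζ ≠ 0 := by
        intro h0
        have := hp.pow_eq_one ζ hζ
        rw [h0, zero_pow hp.weight_ne_zero] at this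
        exact zero_ne_one this
      simp only [Set.mem_ofPred_eq, mem_lattice_iff_of_toTorus_eq hζ h, hp.smul ζ hζ z w h i]
      simp [hχ]
    · intro ζ hζ z w h i a b hab
      -- Here fᵃgᵇ = p⁻ᵇ scales by χ⁻ᵇ, which is χᵃ because a + b = k and χᵏ = 1.
      have h1 := hp.pow_eq_one ζ hζ
      rw [← hab, pow_add] at h1
      rw [hp.smul ζ hζ z w h i, one_pow, one_mul, one_mul, mul_inv, mul_pow,
        inv_pow (χ ζ), ← eq_inv_of_mul_eq_one_left h1]
  · refine ⟨(lattice : Set ℂ)ᶜ, p, fun _ => 1, hc, ?_⟩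
    constructor
    · exact isOpen_compl_lattice
    · exact fun z hz => hp.analyticAt z hz
    · exact fun _ _ => analyticAt_const
    · exact fun _ _ _ => one_ne_zero
    · exact fun z _ _ => (mul_one _).symm
    · exact fun z hz hl => absurd hl hz
    · exact fun ζ hζ z w h i => (mem_lattice_iff_of_toTorus_eq hζ h i).not
    · intro ζ hζ z w h i a b _
      rw [hp.smul ζ hζ z w h i]
      ring

/-! ### Holomorphic functions on `Y` -/

theorem Y.isOpen_lift {P : C3 → Prop} (hP : IsInvariant P) (ho : IsOpen {z | P z}) :
    IsOpen {y | Y.lift P hP y} :=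
  Y.isQuotientMap_mk.isOpen_preimage.mp (ho.preimage BlowUp.continuous_z)

theorem Y.holAt_lift {P : C3 → Prop} (hP : IsInvariant P) {F : C3 → ℂ} (hF : IsInvariant F)
    (h : ∀ z, P z → AnalyticAt ℂ F z) {y : Y} (hy : Y.lift P hP y) :
    Y.HolAt (Y.lift F hF) y := by
  rintro x rfl
  exact BlowUp.holAt_of_analyticAt (h x.z hy) (Filter.Eventually.of_forall fun _ => rfl)

theorem isInvariant_of_charts {p : ℂ → ℂ} {k : ℕ} {χ : ℂˣ → ℂ} {N : Fin 3 → Set ℂ}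
    {f g : Fin 3 → ℂ → ℂ} (hN : ∀ i, IsHomogeneousChart p k χ (N i) (f i) (g i)) :
    IsInvariant fun z : C3 => ∀ i, z i ∈ N i := fun ζ hζ z w h =>
  propext (forall_congr' fun i => (hN i).mem_iff ζ hζ z w h i)

theorem isOpen_of_charts {p : ℂ → ℂ} {k : ℕ} {χ : ℂˣ → ℂ} {N : Fin 3 → Set ℂ}
    {f g : Fin 3 → ℂ → ℂ} (hN : ∀ i, IsHomogeneousChart p k χ (N i) (f i) (g i)) :
    IsOpen {z : C3 | ∀ i, z i ∈ N i} := by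
  simp only [Set.ofPred_forall]
  exact isOpen_iInter_of_finite fun i => (hN i).isOpen.preimage (continuous_apply i)

theorem analyticAt_coordinate (i : Fin 3) (z : C3) : AnalyticAt ℂ (fun w : C3 => w i) z :=
  (ContinuousLinearMap.proj (R := ℂ) (φ := fun _ : Fin 3 => ℂ) i).analyticAt z

/-- Homogenising the product of the defining inequalities gives one local equation, with x₂ ≠ 0
rewritten as y₂² ≠ 1. Only squares occur, so the sign by which y changes disappears and the equation
descends to `Y`. -/
theorem isAnalyticSubset_compl_regularY : Y.IsAnalyticSubset regularYᶜ := by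
  intro y
  obtain ⟨x, rfl⟩ := Y.mk_surjective y
  choose N f g hmem hN using fun i => isSemiInvariant_py.exists_chart (x.z i)
  set F : C3 → ℂ := fun z => g 0 (z 0) ^ 2 * g 1 (z 1) ^ 2 * g 2 (z 2) ^ 2 * f 2 (z 2) ^ 2
    * (f 2 (z 2) ^ 2 - g 2 (z 2) ^ 2)
    * (f 0 (z 0) ^ 2 * g 2 (z 2) ^ 2 - f 2 (z 2) ^ 2 * g 0 (z 0) ^ 2) with hFdef
  have hF : IsInvariant F := by
    intro ζ hζ z w h
    have hg : ∀ i, g i (w i) ^ 2 = g i (z i) ^ 2 := fun i => by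
      simpa using (hN i).smul ζ hζ z w h i 0 2 rfl
    have hf : ∀ i, f i (w i) ^ 2 = f i (z i) ^ 2 := fun i => by
      have := (hN i).smul ζ hζ z w h i 2 0 rfl
      rw [isSemiInvariant_py.pow_eq_one ζ hζ] at this
      simpa using this
    simp only [hFdef, hg, hf]
  have hFa : ∀ z : C3, (∀ i, z i ∈ N i) → AnalyticAt ℂ F z := by
    intro z hz
    have hf : ∀ i, AnalyticAt ℂ (fun w : C3 => f i (w i)) z := fun i =>
      ((hN i).analyticAt_fst _ (hz i)).comp_of_eq (analyticAt_coordinate i z) rfl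
    have hg : ∀ i, AnalyticAt ℂ (fun w : C3 => g i (w i)) z := fun i =>
      ((hN i).analyticAt_snd _ (hz i)).comp_of_eq (analyticAt_coordinate i z) rfl
    have hf2 := fun i => (hf i).pow 2
    have hg2 := fun i => (hg i).pow 2
    exact (((((hg2 0).mul (hg2 1)).mul (hg2 2)).mul (hf2 2)).mul ((hf2 2).sub (hg2 2))).mul
      (((hf2 0).mul (hg2 2)).sub ((hf2 2).mul (hg2 0)))
  have hinv := isInvariant_of_charts hN
  refine ⟨{y | Y.lift _ hinv y}, Y.isOpen_lift hinv (isOpen_of_charts hN), hmem,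
    1, fun _ => Y.lift F hF, fun _ y' hy' => Y.holAt_lift hinv hF hFa hy', ?_⟩
  intro y' hy'
  obtain ⟨x', rfl⟩ := Y.mk_surjective y'
  have hz : ∀ i, x'.z i ∈ N i := hy'
  rw [Set.mem_compl_iff, mk_mem_regularY, forall_const, Y.lift_mk, not_iff_comm]
  generalize x'.z = z at hz
  constructor
  · intro hne
    simp only [hFdef, mul_eq_zero, not_or] at hne
    obtain ⟨⟨⟨⟨⟨g0, g1⟩, g2⟩, f2⟩, h1⟩, h2⟩ := hne
    have hL : ∀ i, g i (z i) ^ 2 ≠ 0 → z i ∉ lattice := fun i hi hl =>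
      hi (by rw [(hN i).eq_zero _ (hz i) hl]; norm_num)
    have l2 := hL 2 g2
    have e0 := (hN 0).eq_mul _ (hz 0) (hL 0 g0)
    have e2 := (hN 2).eq_mul _ (hz 2) l2
    rw [e2] at f2 h1
    rw [e0, e2] at h2
    refine ⟨hL 0 g0, hL 1 g1, ?_, ?_, ?_⟩
    · intro h
      have := py_sq l2
      rw [h] at this
      exact h1 (by linear_combination g 2 (z 2) ^ 2 * this)
    · intro h
      exact f2 (by rw [h]; ring)
    · intro h
      exact h2 (by linear_combination g 0 (z 0) ^ 2 * g 2 (z 2) ^ 2 * h)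
  · intro hr
    have hL := notMem_lattice_of_mem_regularLocus hr
    have hg := fun i => (hN i).ne_zero _ (hz i) (hL i)
    have e := fun i => (hN i).eq_mul _ (hz i) (hL i)
    obtain ⟨-, -, h2, h3, h4⟩ := hr
    simp only [hFdef, e]
    have k1 : (py (z 2) * g 2 (z 2)) ^ 2 - g 2 (z 2) ^ 2 = px (z 2) ^ 3 * g 2 (z 2) ^ 2 := by
      linear_combination g 2 (z 2) ^ 2 * py_sq (hL 2)
    have k2 : (py (z 0) * g 0 (z 0)) ^ 2 * g 2 (z 2) ^ 2 - (py (z 2) * g 2 (z 2)) ^ 2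
        * g 0 (z 0) ^ 2 = (py (z 0) ^ 2 - py (z 2) ^ 2) * (g 0 (z 0) ^ 2 * g 2 (z 2) ^ 2) := by
      ring
    rw [k1, k2]
    have := sub_ne_zero.mpr h4
    have := hg 0
    have := hg 1
    have := hg 2
    positivity

/-- The quotient of the values of a semi-invariant function at two coordinates is meromorphic. -/
theorem isMeromorphic_ratio {p : ℂ → ℂ} {k : ℕ} {χ : ℂˣ → ℂ} (hp : IsSemiInvariant p k χ)
    (i j : Fin 3) (hj : ∀ z ∈ regularLocus, p (z j) ≠ 0) (φ : regularY → ℂ)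
    (hφ : ∀ (x : BlowUp) (hx : x.z ∈ regularLocus), φ ⟨Y.mk x, hx⟩ = p (x.z i) / p (x.z j)) :
    Y.IsMeromorphic regularY φ := by
  intro y
  obtain ⟨x, rfl⟩ := Y.mk_surjective y
  choose N f g hmem hN using fun i => hp.exists_chart (x.z i)
  obtain ⟨m, rfl⟩ := Nat.exists_eq_succ_of_ne_zero hp.weight_ne_zero
  -- The fraction pᵢ/pⱼ = fᵢgⱼ/(gᵢfⱼ) is expanded by gᵢᵐfⱼᵐ with k = m + 1. Each factor then has
  -- degree k, and the characters cancel: χᵏ = 1 in `H`, χ · χᵐ = 1 in `F`.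
  set H : C3 → ℂ := fun z => g i (z i) ^ (m + 1) * f j (z j) ^ (m + 1) with hHdef
  set F : C3 → ℂ := fun z => f i (z i) * g i (z i) ^ m * (f j (z j) ^ m * g j (z j)) with hFdef
  have hH : IsInvariant H := by
    intro ζ hζ z w h
    have h1 := (hN i).smul ζ hζ z w h i 0 (m + 1) (by omega)
    have h2 := (hN j).smul ζ hζ z w h j (m + 1) 0 (by omega)
    rw [hp.pow_eq_one ζ hζ] at h2
    simp only [pow_zero, one_mul, mul_one] at h1 h2
    simp only [hHdef, h1, h2]
  have hF : IsInvariant F := by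
    intro ζ hζ z w h
    have h1 := (hN i).smul ζ hζ z w h i 1 m (by omega)
    have h2 := (hN j).smul ζ hζ z w h j m 1 (by omega)
    have h3 := hp.pow_eq_one ζ hζ
    rw [Nat.succ_eq_add_one, pow_succ] at h3
    simp only [pow_one] at h1 h2
    simp only [hFdef, h1, h2]
    linear_combination (f i (z i) * g i (z i) ^ m * (f j (z j) ^ m * g j (z j))) * h3
  have hHF : ∀ z : C3, (∀ i, z i ∈ N i) → AnalyticAt ℂ F z ∧ AnalyticAt ℂ H z := by
    intro z hz
    have hf : ∀ i, AnalyticAt ℂ (fun w : C3 => f i (w i)) z := fun i =>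
      ((hN i).analyticAt_fst _ (hz i)).comp_of_eq (analyticAt_coordinate i z) rfl
    have hg : ∀ i, AnalyticAt ℂ (fun w : C3 => g i (w i)) z := fun i =>
      ((hN i).analyticAt_snd _ (hz i)).comp_of_eq (analyticAt_coordinate i z) rfl
    exact ⟨((hf i).mul ((hg i).pow m)).mul (((hf j).pow m).mul (hg j)),
      ((hg i).pow (m + 1)).mul ((hf j).pow (m + 1))⟩
  have hinv := isInvariant_of_charts hN
  have hVo := Y.isOpen_lift hinv (isOpen_of_charts hN)
  refine ⟨{y | Y.lift _ hinv y}, hVo, hmem, Y.lift F hF, Y.lift H hH,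
    fun y' hy' => ⟨Y.holAt_lift hinv hF (fun z hz => (hHF z hz).1) hy',
      Y.holAt_lift hinv hH (fun z hz => (hHF z hz).2) hy'⟩, ?_, ?_⟩
  · refine (dense_regularY.open_subset_closure_inter hVo).trans (closure_mono ?_)
    rintro y' ⟨hV, hr⟩
    obtain ⟨x', rfl⟩ := Y.mk_surjective y'
    have hz : ∀ i, x'.z i ∈ N i := hV
    have hr : x'.z ∈ regularLocus := hr
    have hL := notMem_lattice_of_mem_regularLocus hr
    refine ⟨hV, mul_ne_zero (pow_ne_zero _ ((hN i).ne_zero _ (hz i) (hL i))) (pow_ne_zero _ ?_)⟩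
    rw [(hN j).eq_mul _ (hz j) (hL j)]
    exact mul_ne_zero (hj _ hr) ((hN j).ne_zero _ (hz j) (hL j))
  · rintro ⟨y', hr⟩ hV
    obtain ⟨x', rfl⟩ := Y.mk_surjective y'
    have hz : ∀ i, x'.z i ∈ N i := hV
    have hr' : x'.z ∈ regularLocus := hr
    have hL := notMem_lattice_of_mem_regularLocus hr'
    have hpj := hj _ hr'
    rw [hφ x' hr']
    change H x'.z * _ = F x'.z
    simp only [hHdef, hFdef, (hN i).eq_mul _ (hz i) (hL i), (hN j).eq_mul _ (hz j) (hL j)]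
    field_simp
    ring

theorem isMeromorphic_ratioHomeomorph (k : Fin 4) :
    Y.IsMeromorphic regularY fun u => (ratioHomeomorph u : Fin 4 → ℂ) k := by
  fin_cases k
  · exact isMeromorphic_ratio isSemiInvariant_py 0 2 (fun z hz => hz.2.2.2.1) _
      fun _ _ => rfl
  · exact isMeromorphic_ratio isSemiInvariant_py 1 2 (fun z hz => hz.2.2.2.1) _
      fun _ _ => rfl
  · exact isMeromorphic_ratio isSemiInvariant_px 0 2 (fun z hz => hz.2.2.1) _
      fun _ _ => rfl
  · exact isMeromorphic_ratio isSemiInvariant_px 1 2 (fun z hz => hz.2.2.1) _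
      fun _ _ => rfl

end TorusQuotient

end

theorem theorem2p5 : TorusQuotient.Y.BirationalTo TorusQuotient.hypersurfaceQ := by
  open TorusQuotient in
  exact ⟨regularY, regularImage, ratioHomeomorph, isAnalyticSubset_compl_regularY, dense_regularY,
    isZariskiDenseOpen_regularImage, holAt_iff, isMeromorphic_ratioHomeomorph⟩
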